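/- **Proposition.** Let $a,b$ be square-free integers with $a\equiv 1\pmod 4$ such that $L=\mathbb{Q}(\sqrt a,\sqrt b)$ has degree $4$ over $\mathbb{Q}$, let $G=\mathrm{Gal}(L/\mathbb{Q})$ and let $g=\gcd(a,b)>0$. Let $\tau\in G$ be the non-trivial automorphism fixing $\sqrt a$ and let $\sigma\in G$ be an automorphism with $\sigma(\sqrt a)\ne\sqrt a$. Let $\mu\in\mathrm{Perm}(G)$ be left translation by $\tau$, let $\eta\in\mathrm{Perm}(G)$ be the $4$-cycle $(1,\sigma\tau,\tau,\sigma)$, and put $N=\langle\mu,\eta\rangle$. Let $H=L[N]^G$, where $G$ acts on $L$ by the Galois action and on $N$ by conjugation by left translations, acting on $L$ by $\bigl(\sum_{\nu\in N}c_\nu\,\nu\bigr)\cdot y=\sum_{\nu\in N}c_\nu\,\nu^{-1}(1)(y)$; this is the non-classical Hopf-Galois structure of $L/\mathbb{Q}$ given by $\sqrt a$ (with $\mathbb{Q}$-basis $\mathrm{Id},\ \mu,\ \eta+\mu\eta,\ \sqrt a\,(\eta-\mu\eta)$). Let $\mathfrak{A}_H=\{h\in H : h\cdot\mathcal{O}_L\subseteq\mathcal{O}_L\}$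 be its associated order. 1. If $a\equiv1\pmod 8$ and $g\equiv1\pmod 4$, or $a\equiv5\pmod 8$ and $g\equiv3\pmod 4$, then $x^2+ay^2=-2g$ has no solution modulo $8$, hence no solution in integers $x,y$; and $\mathcal{O}_L$ is a free $\mathfrak{A}_H$-module if and only if $x^2+ay^2=2g$ is solvable in integers $x,y$. 2. If $a\equiv1\pmod 8$ and $g\equiv3\pmod 4$, or $a\equiv5\pmod 8$ and $g\equiv1\pmod 4$, then $x^2+ay^2=2g$ has no solution modulo $8$, hence no solution in integers $x,y$; and $\mathcal{O}_L$ is a free $\mathfrak{A}_H$-module if and only if $x^2+ay^2=-2g$ is solvable in integers $x,y$. -/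

import Mathlib

noncomputable section

open NumberField

namespace HopfGalois

section General

variable {K L : Type*} [Field K] [Field L] [Algebra K L]

/-- The semilinear action of `g` in `G = Gal(L/K)` on the group algebra `L[Perm G]`:
`g (∑ c_η η) = ∑ g(c_η) λ(g) η λ(g)⁻¹`, where `λ(g)` is left translation by `g`. -/
def twist (g : Gal(L/K)) :
    MonoidAlgebra L (Equiv.Perm Gal(L/K)) →ₐ[K] MonoidAlgebra L (Equiv.Perm Gal(L/K)) :=
  (MonoidAlgebra.mapAlgHom _ (g : L →ₐ[K] L)).comp
    (MonoidAlgebra.mapDomainAlgHom K L (MulAut.conj (Equiv.mulLeft g)).toMonoidHom)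

/-- The underlying algebra of the Greither-Pareigis Hopf algebra `H = L[N]^G` attached to a
subgroup `N` of `Perm G` (in use: `N` regular and normalised by the left translations): the
elements of `L[Perm G]` that lie in `L[N]` and are fixed by the action of `G`. -/
def hopfAlgebra (N : Subgroup (Equiv.Perm Gal(L/K))) :
    Subalgebra K (MonoidAlgebra L (Equiv.Perm Gal(L/K))) :=
  (MonoidAlgebra.mapDomainAlgHom K L N.subtype).range ⊓
    ⨅ g : Gal(L/K), AlgHom.equalizer (twist g) (AlgHom.id K _)

/-- The Greither-Pareigis formula `(∑ c_η η) · y = ∑ c_η (η⁻¹(1_G))(y)`. -/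
def actionLinear : MonoidAlgebra L (Equiv.Perm Gal(L/K)) →ₗ[K] Module.End K L where
  toFun x := x.coeff.sum fun η c => c • (η⁻¹ (1 : Gal(L/K))).toLinearMap
  map_add' x y := by
    rw [MonoidAlgebra.coeff_add, Finsupp.sum_add_index']
    · simp
    · intros; rw [add_smul]
  map_smul' k x := by
    rw [MonoidAlgebra.coeff_smul, Finsupp.sum_smul_index' (by simp), Finsupp.sum, Finsupp.sum,
      Finset.smul_sum]
    simp

theorem actionLinear_single (η : Equiv.Perm Gal(L/K)) (c : L) (y : L) :
    actionLinear (MonoidAlgebra.single η c) y = c * (η⁻¹ (1 : Gal(L/K))) y := by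
  simp [actionLinear]

theorem actionLinear_single_mul (η : Equiv.Perm Gal(L/K)) (c : L)
    (x : MonoidAlgebra L (Equiv.Perm Gal(L/K))) :
    actionLinear (MonoidAlgebra.single η c * twist (η⁻¹ (1 : Gal(L/K))) x) =
      actionLinear (MonoidAlgebra.single η c) * actionLinear x := by
  induction x using MonoidAlgebra.induction_linear with
  | zero => simp
  | add f g hf hg => simp only [map_add, mul_add, hf, hg]
  | single m d =>
    ext z
    have h : twist (η⁻¹ (1 : Gal(L/K))) (MonoidAlgebra.single m d) =
        MonoidAlgebra.single (MulAut.conj (Equiv.mulLeft (η⁻¹ (1 : Gal(L/K)))) m)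
          ((η⁻¹ (1 : Gal(L/K))) d) := by
      simp [twist]
    rw [h, MonoidAlgebra.single_mul_single, Module.End.mul_apply, actionLinear_single,
      actionLinear_single, actionLinear_single]
    simp [mul_assoc]

/-- The action of `H = L[N]^G` on `L`, as a homomorphism of algebras `H → End_K(L)`. -/
def action (N : Subgroup (Equiv.Perm Gal(L/K))) : hopfAlgebra N →ₐ[K] Module.End K L :=
  AlgHom.ofLinearMap (actionLinear ∘ₗ (hopfAlgebra N).val.toLinearMap)
    (by
      ext z
      simp [MonoidAlgebra.one_def, actionLinear_single])
    (by
      rintro ⟨x, hx⟩ ⟨y, hy⟩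
      have hy' : ∀ g : Gal(L/K), twist g y = y := by
        have h2 := (Algebra.mem_inf.1 hy).2
        rw [Algebra.mem_iInf] at h2
        exact fun g => h2 g
      change actionLinear (x * y) = actionLinear x * actionLinear y
      clear hx hy
      induction x using MonoidAlgebra.induction_linear with
      | zero => simp
      | add f g hf hg => simp only [map_add, add_mul, hf, hg]
      | single η c =>
        rw [← actionLinear_single_mul, hy'])

end General

section AssociatedOrder

variable {K L H : Type*} [Field K] [Field L] [Algebra K L] [Ring H] [Algebra K H]

/-- For a `K`-algebra `H` acting on `L` through `ρ : H → End_K(L)`, the associated order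
`𝔄_H = {h ∈ H | h · 𝓞_L ⊆ 𝓞_L}`. -/
def associatedOrder (ρ : H →ₐ[K] Module.End K L) : Subring H where
  carrier := {h | ∀ y : 𝓞 L, ∃ z : 𝓞 L, ρ h (y : L) = (z : L)}
  mul_mem' {h k} hh hk y := by
    obtain ⟨z, hz⟩ := hk y
    obtain ⟨w, hw⟩ := hh z
    exact ⟨w, by rw [map_mul, Module.End.mul_apply, hz, hw]⟩
  one_mem' y := ⟨y, by simp⟩
  add_mem' {h k} hh hk y := by
    obtain ⟨z, hz⟩ := hh y
    obtain ⟨w, hw⟩ := hk y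
    exact ⟨z + w, by simp [hz, hw]⟩
  zero_mem' y := ⟨0, by simp⟩
  neg_mem' {h} hh y := by
    obtain ⟨z, hz⟩ := hh y
    exact ⟨-z, by simp [hz]⟩

/-- `h · y`, for `h` in the associated order and `y` in `𝓞_L`. -/
def orderSMul (ρ : H →ₐ[K] Module.End K L) (h : associatedOrder ρ) (y : 𝓞 L) : 𝓞 L :=
  ⟨ρ (h : H) (y : L), by
    obtain ⟨z, hz⟩ := h.2 y
    rw [hz]
    exact z.2⟩

/-- `𝓞_L` as a module over the associated order. -/
instance (ρ : H →ₐ[K] Module.End K L) : Module (associatedOrder ρ) (𝓞 L) where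
  smul := orderSMul ρ
  one_smul y := by
    apply RingOfIntegers.ext
    change ρ 1 (y : L) = y
    simp
  mul_smul h k y := by
    apply RingOfIntegers.ext
    change ρ ((h : H) * (k : H)) (y : L) = ρ (h : H) (ρ (k : H) (y : L))
    simp
  smul_zero h := by
    apply RingOfIntegers.ext
    change ρ (h : H) ((0 : 𝓞 L) : L) = ((0 : 𝓞 L) : L)
    simp
  smul_add h x y := by
    apply RingOfIntegers.ext
    change ρ (h : H) ((x + y : 𝓞 L) : L) = ρ (h : H) (x : L) + ρ (h : H) (y : L)
    simp
  add_smul h k y := by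
    apply RingOfIntegers.ext
    change ρ ((h : H) + (k : H)) (y : L) = ρ (h : H) (y : L) + ρ (k : H) (y : L)
    simp
  zero_smul y := by
    apply RingOfIntegers.ext
    change ρ (0 : H) (y : L) = ((0 : 𝓞 L) : L)
    simp

theorem coe_smul (ρ : H →ₐ[K] Module.End K L) (h : associatedOrder ρ) (y : 𝓞 L) :
    ((h • y : 𝓞 L) : L) = ρ (h : H) (y : L) := rfl

end AssociatedOrder

section Klein

open scoped Classical in
/-- For an elementary abelian group `G = ⟨σ, τ⟩` of order `4` and `T = ⟨τ⟩`, the subgroup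
`N_{T,1} = ⟨μ, η⟩` of `Perm G`, where `μ = λ(τ)` and `η` is the `4`-cycle
`1 ↦ σ τ ↦ τ ↦ σ ↦ 1`. -/
def cyclicRegular {G : Type*} [Group G] (σ τ : G) : Subgroup (Equiv.Perm G) :=
  Subgroup.closure {Equiv.mulLeft τ, List.formPerm [1, σ * τ, τ, σ]}

end Klein

/-- The associated order `𝔄_H` in the non-classical Hopf-Galois structure `H = L[N_{T,1}]^G` of
a biquadratic field `L` with `Gal(L/ℚ) = ⟨σ, τ⟩` and `T = ⟨τ⟩`. It is the structure given by
`√a` when `ℚ(√a)` is the fixed field of `τ`. -/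
abbrev nonclassicalOrder {L : Type*} [Field L] [NumberField L] (σ τ : Gal(L/ℚ)) :
    Subring (hopfAlgebra (cyclicRegular σ τ)) :=
  associatedOrder (action (cyclicRegular σ τ))

end HopfGalois

end

open NumberField

namespace HopfGalois

/-! Put `a = g a'`, `b = g b'` and `δ = α β / g`, so that `1, α, β, δ` is a rational basis of `L`.
In this basis `H` acts diagonally by blocks: by a scalar `u` on `1`, by a scalar `v` on `α`, and on
the plane of `β` and `δ` by `w + z J`, where `J β = g δ` and `J δ = -a' β`. Since `J² = -a`, the
plane is a line over `ℚ(√-a)`, and it carries the form `g r² + a' s²`, which `w + z J` multiplies by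
the norm `w² + a z²`.

Let `M` be the lattice of all `(R β + S δ) / 2` with `R ≡ S` mod 2. The integers of `L` lying in the
plane form `M`, and the projection of `𝓞 L` to the plane is `M` or `M / 2`. Elements of the
associated order have integral `w, z` (`exists_int_of_mem`). Hence, if `θ` generates `𝓞 L`, its
plane component generates the projection over a subring of `ℤ[J]`, and half its form value, suitably
scaled, divides the values `2 g` at `β` and `(g + a') / 2` at `(β + δ) / 2`. These are coprime, so
the value is `±1`, and multiplying by `g` gives `x² + a y² = ±2 g` (`solvable_of_generator`).

Conversely, a solution has `g ∣ x`, and dividing by `g` gives `g X² + a' Y² = ±2`. An integer with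
plane coordinates proportional to `(X, Y)` then generates: dividing by it in the plane introduces
only the denominator 2, which parity removes, and the remaining congruences put the quotient in the
associated order (`free_of_norm_form`). So freeness amounts to solvability for one of the two signs
(`free_iff`), and reduction mod 8 rules out one sign. -/

/-- A biquadratic field `L = ℚ(α, β)` with `α² = a = g a'`, `β² = b = g b'`, `g δ = α β`, and
automorphisms `σ`, `τ` generating its Galois group, where `τ` fixes `α` and `σ β = e β`. -/
structure Biquadratic {L : Type*} [Field L] [NumberField L] (g a' b' e : ℤ) (α β δ : L)
    (σ τ : Gal(L/ℚ)) : Prop where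
  finrank_eq : Module.finrank ℚ L = 4
  squarefree_a : Squarefree (g * a')
  squarefree_b : Squarefree (g * b')
  squarefree_k : Squarefree (a' * b')
  g_pos : 0 < g
  sq_α : α ^ 2 = g * a'
  sq_β : β ^ 2 = g * b'
  g_mul_δ : g * δ = α * β
  σ_α : σ α = -α
  τ_α : τ α = α
  τ_β : τ β = -β
  σ_β : σ β = e * β
  sign : e = 1 ∨ e = -1
  ext : ∀ φ ψ : Gal(L/ℚ), φ α = ψ α → φ β = ψ β → φ = ψ
  α_ne : α ≠ 0
  β_ne : β ≠ 0
  mod_four : g * a' ≡ 1 [ZMOD 4]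

/-! ### Coordinates in the basis 1, α, β, δ -/

section Coordinates

variable {L : Type*} [Field L] [NumberField L]

/-- The hypothesis on `σ` fixes its effect on `α` only; its effect on `β` is a sign, carried along
as `e` so that both choices of `σ` are treated at once. -/
theorem Biquadratic.of_adjoin_eq_top (a b : ℤ)
    (ha : Squarefree a) (hb : Squarefree b) (ha4 : a ≡ 1 [ZMOD 4])
    (α β : L) (hα : α ^ 2 = (a : L)) (hβ : β ^ 2 = (b : L))
    (hgen : IntermediateField.adjoin ℚ {α, β} = ⊤) (hdeg : Module.finrank ℚ L = 4)
    (σ τ : Gal(L/ℚ)) (hτ : τ ≠ 1) (hτα : τ α = α) (hσα : σ α ≠ α) :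
    ∃ a' b' e : ℤ, ∃ δ : L, a = Int.gcd a b * a' ∧
      Biquadratic (Int.gcd a b : ℤ) a' b' e α β δ σ τ := by
  have ha0 : a ≠ 0 := ha.ne_zero
  have hb0 : b ≠ 0 := hb.ne_zero
  have hα0 : α ≠ 0 := by
    rintro rfl
    simp at hσα
  have hβ0 : β ≠ 0 := by
    rintro rfl
    apply hb0
    have : (b : L) = 0 := by rw [← hβ]; simp
    exact_mod_cast this
  obtain ⟨g, hg⟩ : ∃ g : ℤ, (Int.gcd a b : ℤ) = g := ⟨_, rfl⟩
  have hgpos : 0 < g := by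
    rw [← hg]; exact_mod_cast Int.gcd_pos_of_ne_zero_left b ha0
  obtain ⟨a', ha'⟩ : g ∣ a := hg ▸ Int.gcd_dvd_left a b
  obtain ⟨b', hb'⟩ : g ∣ b := hg ▸ Int.gcd_dvd_right a b
  have hcop : IsCoprime a' b' := by
    rw [Int.isCoprime_iff_gcd_eq_one]
    have h1 : Int.gcd (g * a') (g * b') = g.natAbs * Int.gcd a' b' := Int.gcd_mul_left ..
    rw [← ha', ← hb'] at h1
    have h2 : g.natAbs = Int.gcd a b := by rw [← hg]; simp
    rw [h2] at h1
    have h3 : 0 < Int.gcd a b := Int.gcd_pos_of_ne_zero_left b ha0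
    exact (Nat.eq_of_mul_eq_mul_left h3 (by rw [← h1, mul_one])).symm
  rw [ha'] at ha
  rw [hb'] at hb
  have hg0 : (g : L) ≠ 0 := by exact_mod_cast hgpos.ne'
  have ext : ∀ φ ψ : Gal(L/ℚ), φ α = ψ α → φ β = ψ β → φ = ψ := by
    intro φ ψ h1 h2
    -- Two automorphisms agreeing on `α` and `β` agree everywhere, because the fixed field of `ψ⁻¹
    -- φ` contains both generators.
    have h3 : (IntermediateField.adjoin ℚ {α, β}) ≤
        AlgHom.fieldRange (IntermediateField.val
          (IntermediateField.fixedField (Subgroup.zpowers (ψ⁻¹ * φ)))) := by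
      rw [IntermediateField.adjoin_le_iff]
      intro x hx
      rw [SetLike.mem_coe, IntermediateField.fieldRange_val, IntermediateField.mem_fixedField_iff]
      intro f hf
      have hx' : (ψ⁻¹ * φ) x = x := by
        have : φ x = ψ x := by
          rcases hx with rfl | rfl
          · exact h1
          · exact h2
        rw [AlgEquiv.mul_apply, this]
        exact ψ.symm_apply_apply x
      have h4 : Subgroup.zpowers (ψ⁻¹ * φ) ≤ MulAction.stabilizer Gal(L/ℚ) x := by
        rw [Subgroup.zpowers_le]
        exact hx'
      exact h4 hf
    ext x
    have hx : x ∈ IntermediateField.adjoin ℚ {α, β} := by rw [hgen]; trivial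
    have := h3 hx
    rw [IntermediateField.fieldRange_val, IntermediateField.mem_fixedField_iff] at this
    have h5 := this _ (Subgroup.mem_zpowers _)
    rw [AlgEquiv.mul_apply] at h5
    have h6 := congrArg ψ h5
    rw [← h6]
    exact (ψ.apply_symm_apply (φ x)).symm
  have hroot : ∀ (φ : Gal(L/ℚ)) (x : L) (n : ℤ), x ^ 2 = n → φ x = x ∨ φ x = -x := by
    intro φ x n h
    apply sq_eq_sq_iff_eq_or_eq_neg.1
    rw [← map_pow, h, map_intCast]
  have hτβ : τ β = -β := by
    refine (hroot τ β b hβ).resolve_left fun h => hτ (ext _ _ ?_ ?_)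
    · rw [hτα]; rfl
    · rw [h]; rfl
  have hσα' : σ α = -α := (hroot σ α a hα).resolve_left hσα
  have key : ∀ e : ℤ, e = 1 ∨ e = -1 → σ β = e * β →
      Biquadratic g a' b' e α β (α * β / g) σ τ := fun e he hσβ =>
    { finrank_eq := hdeg
      squarefree_a := ha
      squarefree_b := hb
      squarefree_k := squarefree_mul_iff.2
        ⟨hcop.isRelPrime, (squarefree_mul_iff.1 ha).2.2, (squarefree_mul_iff.1 hb).2.2⟩
      g_pos := hgpos
      sq_α := by rw [hα, ha']; push_cast; rfl
      sq_β := by rw [hβ, hb']; push_cast; rfl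
      g_mul_δ := by field_simp
      σ_α := hσα'
      τ_α := hτα
      τ_β := hτβ
      σ_β := hσβ
      sign := he
      ext := ext
      α_ne := hα0
      β_ne := hβ0
      mod_four := ha' ▸ ha4 }
  rw [hg]
  rcases hroot σ β b hβ with h | h
  · exact ⟨a', b', 1, _, ha', key 1 (Or.inl rfl) (by rw [h]; push_cast; ring)⟩
  · exact ⟨a', b', -1, _, ha', key (-1) (Or.inr rfl) (by rw [h]; push_cast; ring)⟩

/-- The element `p + q α + r β + s δ`. -/
def comb (α β δ : L) (p q r s : ℚ) : L := p + q * α + r * β + s * δ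

namespace Biquadratic

variable {g a' b' e : ℤ} {α β δ : L} {σ τ : Gal(L/ℚ)} (B : Biquadratic g a' b' e α β δ σ τ)
include B

theorem g_ne : (g : L) ≠ 0 := by exact_mod_cast B.g_pos.ne'

theorem sq_δ : δ ^ 2 = a' * b' := by
  have h := B.g_ne
  have : (g : L) ^ 2 * δ ^ 2 = g ^ 2 * (a' * b') := by
    rw [← mul_pow, B.g_mul_δ, mul_pow, B.sq_α, B.sq_β]; ring
  exact mul_left_cancel₀ (pow_ne_zero 2 h) this

theorem α_mul_β : α * β = g * δ := B.g_mul_δ.symm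

theorem α_mul_δ : α * δ = a' * β := by
  apply mul_left_cancel₀ B.g_ne
  linear_combination α * B.g_mul_δ + β * B.sq_α

theorem β_mul_δ : β * δ = b' * α := by
  apply mul_left_cancel₀ B.g_ne
  linear_combination β * B.g_mul_δ + α * B.sq_β

theorem e_sq : (e : L) ^ 2 = 1 := by
  rcases B.sign with rfl | rfl <;> norm_num

theorem σ_δ : σ δ = -e * δ := by
  apply mul_left_cancel₀ B.g_ne
  have := congrArg σ B.g_mul_δ
  rw [map_mul, map_mul, map_intCast, B.σ_α, B.σ_β] at this
  rw [this]
  linear_combination -e * B.α_mul_β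

theorem τ_δ : τ δ = -δ := by
  apply mul_left_cancel₀ B.g_ne
  have := congrArg τ B.g_mul_δ
  rw [map_mul, map_mul, map_intCast, B.τ_α, B.τ_β] at this
  rw [this]
  linear_combination -B.α_mul_β

theorem δ_ne : δ ≠ 0 := by
  rintro rfl
  have := B.α_mul_β
  simp [B.α_ne, B.β_ne] at this

theorem σ_comb (p q r s : ℚ) : σ (comb α β δ p q r s) = comb α β δ p (-q) (e * r) (-e * s) := by
  simp only [comb, map_add, map_mul, map_ratCast, B.σ_α, B.σ_β, B.σ_δ]
  push_cast
  ring

theorem τ_comb (p q r s : ℚ) : τ (comb α β δ p q r s) = comb α β δ p q (-r) (-s) := by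
  simp only [comb, map_add, map_mul, map_ratCast, B.τ_α, B.τ_β, B.τ_δ]
  push_cast
  ring

/-- The four basis elements are eigenvectors for the four distinct characters of the Galois group,
so signed averages over the conjugates isolate each term. -/
theorem comb_eq_zero {p q r s : ℚ} (h : comb α β δ p q r s = 0) :
    p = 0 ∧ q = 0 ∧ r = 0 ∧ s = 0 := by
  have h1 := congrArg σ h
  have h2 := congrArg τ h
  have h3 := congrArg σ (congrArg τ h)
  rw [map_zero] at h1 h2 h3
  rw [map_zero] at h3
  rw [B.τ_comb] at h2 h3
  rw [B.σ_comb] at h1 h3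
  simp only [comb] at h h1 h2 h3
  push_cast at h h1 h2 h3
  have e0 : (p : L) = 0 := by linear_combination (h + h1 + h2 + h3) / 4
  have e1 : (q : L) * α = 0 := by linear_combination (h - h1 + h2 - h3) / 4
  have e2 : (r : L) * β = 0 := by
    rcases B.sign with rfl | rfl <;> push_cast at *
    · linear_combination (h + h1 - h2 - h3) / 4
    · linear_combination (h - h1 - h2 + h3) / 4
  have e3 : (s : L) * δ = 0 := by
    rcases B.sign with rfl | rfl <;> push_cast at *
    · linear_combination (h - h1 - h2 + h3) / 4
    · linear_combination (h + h1 - h2 - h3) / 4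
  simp only [mul_eq_zero, B.α_ne, B.β_ne, B.δ_ne, or_false, Rat.cast_eq_zero]
    at e0 e1 e2 e3
  exact ⟨e0, e1, e2, e3⟩

theorem comb_inj {p q r s p' q' r' s' : ℚ}
    (h : comb α β δ p q r s = comb α β δ p' q' r' s') : p = p' ∧ q = q' ∧ r = r' ∧ s = s' := by
  have : comb α β δ (p - p') (q - q') (r - r') (s - s') = 0 := by
    simp only [comb] at *
    push_cast
    linear_combination h
  obtain ⟨h1, h2, h3, h4⟩ := B.comb_eq_zero this
  exact ⟨sub_eq_zero.1 h1, sub_eq_zero.1 h2, sub_eq_zero.1 h3, sub_eq_zero.1 h4⟩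

theorem exists_eq_comb (y : L) : ∃ p q r s : ℚ, y = comb α β δ p q r s := by
  have hli : LinearIndependent ℚ ![1, α, β, δ] := by
    rw [Fintype.linearIndependent_iff]
    intro c hc
    have h0 : comb α β δ (c 0) (c 1) (c 2) (c 3) = 0 := by
      rw [← hc]
      simp [Fin.sum_univ_four, comb, Rat.smul_def]
    obtain ⟨h1, h2, h3, h4⟩ := B.comb_eq_zero h0
    intro i
    fin_cases i <;> assumption
  let bs := basisOfLinearIndependentOfCardEqFinrank hli (by rw [B.finrank_eq]; rfl)
  refine ⟨bs.repr y 0, bs.repr y 1, bs.repr y 2, bs.repr y 3, ?_⟩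
  conv_lhs => rw [← bs.sum_repr y]
  simp [Fin.sum_univ_four, comb, Rat.smul_def, bs]

theorem σ_σ : σ * σ = 1 := by
  apply B.ext
  · simp [B.σ_α]
  · simp [B.σ_β, ← mul_assoc, ← sq, B.e_sq]

theorem τ_τ : τ * τ = 1 := by
  apply B.ext
  · simp [B.τ_α]
  · simp [B.τ_β]

theorem τ_σ : τ * σ = σ * τ := by
  apply B.ext
  · simp [B.τ_α, B.σ_α]
  · simp [B.τ_β, B.σ_β]

theorem τ_ne_one : τ ≠ 1 := by
  intro h
  have := B.τ_β
  rw [h] at this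
  exact B.β_ne (self_eq_neg.1 this)

theorem σ_ne_one : σ ≠ 1 := by
  intro h
  have := B.σ_α
  rw [h] at this
  exact B.α_ne (self_eq_neg.1 this)

theorem σ_ne_τ : σ ≠ τ := by
  intro h
  have := B.σ_α
  rw [h, B.τ_α] at this
  exact B.α_ne (self_eq_neg.1 this)

end Biquadratic
end Coordinates
end HopfGalois

/-! ### Integrality conditions from traces and norms -/

namespace HopfGalois

theorem exists_int_of_squarefree_mul_sq {d : ℤ} (hd : Squarefree d) {t : ℚ} {m : ℤ}
    (h : d * t ^ 2 = m) : ∃ n : ℤ, t = n := by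
  have hden : (t.den : ℚ) ≠ 0 := by exact_mod_cast t.den_ne_zero
  have h1 : d * t.num ^ 2 = m * (t.den : ℤ) ^ 2 := by
    have h2 : (d : ℚ) * t.num ^ 2 = m * (t.den : ℚ) ^ 2 := by
      rw [← h]
      nth_rewrite 2 [← Rat.num_div_den t]
      field_simp
    exact_mod_cast h2
  have hc : IsCoprime ((t.den : ℤ) ^ 2) (t.num ^ 2) := by
    apply IsCoprime.pow
    rw [Int.isCoprime_iff_gcd_eq_one, Int.gcd_comm]
    exact t.reduced
  have h3 : (t.den : ℤ) ^ 2 ∣ d := hc.dvd_of_dvd_mul_right ⟨m, by rw [h1]; ring⟩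
  rw [sq] at h3
  have h4 := hd _ h3
  rw [Int.isUnit_iff] at h4
  refine ⟨t.num, ?_⟩
  have : t.den = 1 := by omega
  exact (Rat.coe_int_num_of_den_eq_one this).symm

section Integrality

variable {L : Type*} [Field L] [NumberField L]

theorem isIntegral_of_eq {L : Type*} [Field L] {x y : L} (hx : IsIntegral ℤ x) (h : x = y) : IsIntegral ℤ y := h ▸ hx

theorem exists_int_of_isIntegral {x : ℚ} (h : IsIntegral ℤ (x : L)) : ∃ n : ℤ, x = n := by
  have h1 : IsIntegral ℤ (algebraMap ℚ L x) := by simpa using h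
  rw [isIntegral_algebraMap_iff (algebraMap ℚ L).injective,
    IsIntegrallyClosed.isIntegral_iff] at h1
  obtain ⟨n, hn⟩ := h1
  exact ⟨n, by rw [← hn]; simp⟩

/-- The trace `2 x` and the norm `x² - d y²` are integers, so `d (2 y)²` is an integer; as `d` is
squarefree, `2 y` has no denominator. -/
theorem exists_int_of_isIntegral_quadratic {φ : Gal(L/ℚ)} {ω : L} {d : ℤ} (hd : Squarefree d)
    (hω : ω ^ 2 = d) (hφ : φ ω = -ω) {x y : ℚ} (h : IsIntegral ℤ ((x : L) + y * ω)) :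
    ∃ A C : ℤ, 2 * x = A ∧ 2 * y = C ∧ 4 ∣ A ^ 2 - d * C ^ 2 := by
  have h' : IsIntegral ℤ ((x : L) - y * ω) := by
    have := h.map (φ : L →ₐ[ℚ] L)
    simpa [hφ, ← sub_eq_add_neg] using this
  obtain ⟨A, hA⟩ := exists_int_of_isIntegral (L := L) (x := 2 * x) (by
    refine isIntegral_of_eq (h.add h') ?_; push_cast; ring)
  obtain ⟨n, hn⟩ := exists_int_of_isIntegral (L := L) (x := x ^ 2 - d * y ^ 2) (by
    refine isIntegral_of_eq (h.mul h') ?_; push_cast; rw [← hω]; ring)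
  have h2 : d * (2 * y) ^ 2 = ((A ^ 2 - 4 * n : ℤ) : ℚ) := by
    push_cast
    rw [← hA, ← hn]
    ring
  obtain ⟨C, hC⟩ := exists_int_of_squarefree_mul_sq hd h2
  refine ⟨A, C, hA, hC, n, ?_⟩
  rw [hC] at h2
  have : d * C ^ 2 = A ^ 2 - 4 * n := by exact_mod_cast h2
  linarith

namespace Biquadratic

variable {g a' b' e : ℤ} {α β δ : L} {σ τ : Gal(L/ℚ)} (B : Biquadratic g a' b' e α β δ σ τ)
include B

theorem isIntegral_conj {p q r s : ℚ} (h : IsIntegral ℤ (comb α β δ p q r s)) :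
    IsIntegral ℤ (comb α β δ p q (-r) (-s)) ∧ IsIntegral ℤ (comb α β δ p (-q) r (-s)) ∧
      IsIntegral ℤ (comb α β δ p (-q) (-r) s) := by
  have h1 := h.map τ
  have h2 := h.map σ
  have h3 := h1.map σ
  simp only [B.τ_comb, B.σ_comb] at h1 h2 h3
  rcases B.sign with rfl | rfl
  · simp only [Int.cast_one, one_mul, neg_mul, neg_neg] at h2 h3
    exact ⟨h1, h2, h3⟩
  · simp only [Int.cast_neg, Int.cast_one, one_mul, neg_mul, neg_neg] at h2 h3
    exact ⟨h1, h3, h2⟩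

/-- The traces to the three quadratic subfields bound the denominators by 4 and give the first three
congruences. The norm to `ℚ(α)`, equal to `(A + C α) / 2`, gives the rest. -/
theorem exists_of_isIntegral {y : L} (h : IsIntegral ℤ y) :
    ∃ P Q R S A C : ℤ, y = comb α β δ (P / 4) (Q / 4) (R / 4) (S / 4) ∧
      4 ∣ P ^ 2 - g * a' * Q ^ 2 ∧ 4 ∣ P ^ 2 - g * b' * R ^ 2 ∧ 4 ∣ P ^ 2 - a' * b' * S ^ 2 ∧
      P ^ 2 + g * a' * Q ^ 2 - g * b' * R ^ 2 - a' * b' * S ^ 2 = 8 * A ∧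
      2 * (P * Q - b' * R * S) = 8 * C ∧ 4 ∣ A ^ 2 - g * a' * C ^ 2 := by
  obtain ⟨p, q, r, s, rfl⟩ := B.exists_eq_comb y
  obtain ⟨h1, h2, h3⟩ := B.isIntegral_conj h
  obtain ⟨P, Q, hP, hQ, h4⟩ := exists_int_of_isIntegral_quadratic (φ := σ) (ω := α)
    (x := 2 * p) (y := 2 * q) B.squarefree_a (by rw [B.sq_α]; push_cast; rfl) B.σ_α (by
      refine isIntegral_of_eq (h.add h1) ?_; simp only [comb]; push_cast; ring)
  obtain ⟨P', R, hP', hR, h5⟩ := exists_int_of_isIntegral_quadratic (φ := τ) (ω := β)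
    (x := 2 * p) (y := 2 * r) B.squarefree_b (by rw [B.sq_β]; push_cast; rfl) B.τ_β (by
      refine isIntegral_of_eq (h.add h2) ?_; simp only [comb]; push_cast; ring)
  obtain ⟨P'', S, hP'', hS, h6⟩ := exists_int_of_isIntegral_quadratic (φ := τ) (ω := δ)
    (x := 2 * p) (y := 2 * s) B.squarefree_k (by rw [B.sq_δ]; push_cast; rfl) B.τ_δ (by
      refine isIntegral_of_eq (h.add h3) ?_; simp only [comb]; push_cast; ring)
  obtain rfl : P = P' := by exact_mod_cast hP.symm.trans hP'
  obtain rfl : P = P'' := by exact_mod_cast hP.symm.trans hP''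
  obtain rfl : p = P / 4 := by linarith
  obtain rfl : q = Q / 4 := by linarith
  obtain rfl : r = R / 4 := by linarith
  obtain rfl : s = S / 4 := by linarith
  obtain ⟨A, C, hA, hC, h7⟩ := exists_int_of_isIntegral_quadratic (φ := σ) (ω := α)
    (x := (P ^ 2 + g * a' * Q ^ 2 - g * b' * R ^ 2 - a' * b' * S ^ 2) / 16)
    (y := 2 * (P * Q - b' * R * S) / 16) B.squarefree_a (by rw [B.sq_α]; push_cast; rfl) B.σ_α (by
      refine isIntegral_of_eq (h.mul h1) ?_
      simp only [comb]
      push_cast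
      linear_combination (Q : L) ^ 2 / 16 * B.sq_α - (R : L) ^ 2 / 16 * B.sq_β -
        (S : L) ^ 2 / 16 * B.sq_δ - (2 * R * S : L) / 16 * B.β_mul_δ)
  refine ⟨P, Q, R, S, A, C, rfl, h4, h5, h6, ?_, ?_, h7⟩
  · have : ((P ^ 2 + g * a' * Q ^ 2 - g * b' * R ^ 2 - a' * b' * S ^ 2 : ℤ) : ℚ) = (8 * A : ℤ) := by
      push_cast
      linarith
    exact_mod_cast this
  · have : ((2 * (P * Q - b' * R * S) : ℤ) : ℚ) = (8 * C : ℤ) := by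
      push_cast
      linarith
    exact_mod_cast this

end Biquadratic
end Integrality
end HopfGalois

/-! ### The ring of integers described by congruences mod 4 -/

namespace HopfGalois

section Residues

theorem four_dvd_iff (n : ℤ) : 4 ∣ n ↔ (n : ZMod 4) = 0 :=
  (ZMod.intCast_zmod_eq_zero_iff_dvd n 4).symm

/-- Encoding parity inside `ZMod 4` turns mixed conditions mod 2 and mod 4 into finite statements
that `decide` settles. -/
theorem two_dvd_iff (n : ℤ) : 2 ∣ n ↔ 2 * (n : ZMod 4) = 0 := by
  have : (2 * (n : ZMod 4)) = ((2 * n : ℤ) : ZMod 4) := by push_cast; rfl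
  rw [this, ← four_dvd_iff]
  omega

theorem residues_all_odd : ∀ g P Q R S : ZMod 4, g * g = 1 → P * P = 1 → Q * Q = 1 → R * R = 1 →
    S * S = 1 → P * Q - g * R * S = 0 → P + g * Q + R + S = 0 := by
  decide

theorem residues_sum_even : ∀ g P Q R S : ZMod 4, g * g = 1 →
    P ^ 2 + Q ^ 2 - R ^ 2 - S ^ 2 = 2 * (P * Q - g * R * S) → 2 * (P + g * Q + R + S) = 0 := by
  decide

theorem residues_even : ∀ g b P Q R S : ZMod 4, g * g = 1 → (b = 2 ∨ b = 3) →
    P ^ 2 + Q ^ 2 - b * R ^ 2 - b * S ^ 2 = 2 * (P * Q - g * b * R * S) →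
    2 * (P - Q) = 0 ∧ 2 * (R - S) = 0 := by
  decide

theorem residues_sub : ∀ g P Q R S : ZMod 4, g * g = 1 → 2 * (P - Q) = 0 → 2 * (P - R) = 0 →
    2 * (P - S) = 0 → P + g * Q + R + S = 0 → P - Q - R + g * S = 0 := by
  decide

theorem mul_self_eq_one_of_mul_eq_one : ∀ g a : ZMod 4, g * a = 1 → g * g = 1 ∧ a = g := by
  decide

theorem two_mul_sub_eq_zero_of_sq : ∀ P Q : ZMod 4, P ^ 2 - Q ^ 2 = 0 → 2 * (P - Q) = 0 := by
  decide

theorem two_mul_eq_zero_of_sq : ∀ b P Q : ZMod 4, (b = 2 ∨ b = 3) → P ^ 2 - b * Q ^ 2 = 0 →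
    2 * P = 0 ∧ 2 * Q = 0 := by
  decide

theorem mul_self_eq_one_of_two_mul_ne_zero : ∀ P : ZMod 4, 2 * P ≠ 0 → P * P = 1 := by
  decide

end Residues

theorem isIntegral_half_one_add {L : Type*} [Field L] [CharZero L] {ω : L} {d : ℤ}
    (h : ω ^ 2 = d) (hd : d ≡ 1 [ZMOD 4]) : IsIntegral ℤ ((1 + ω) / 2) := by
  obtain ⟨m, hm⟩ := hd.symm.dvd
  refine ⟨Polynomial.X ^ 2 - Polynomial.X - Polynomial.C m, by monicity!, ?_⟩
  have hm' : (d : L) - 1 = 4 * m := by exact_mod_cast hm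
  simp only [Polynomial.eval₂_sub, Polynomial.eval₂_pow, Polynomial.eval₂_X, Polynomial.eval₂_C]
  rw [eq_intCast]
  linear_combination (1 / 4 : L) * h + (1 / 4 : L) * hm'

section Integrality

variable {L : Type*} [Field L] [NumberField L]

namespace Biquadratic

variable {g a' b' e : ℤ} {α β δ : L} {σ τ : Gal(L/ℚ)} (B : Biquadratic g a' b' e α β δ σ τ)
include B

theorem cast_g_mul_a' : (g : ZMod 4) * a' = 1 := by
  have := (ZMod.intCast_eq_intCast_iff _ _ 4).2 B.mod_four
  push_cast at this
  exact this

theorem cast_a' : (a' : ZMod 4) = g := (mul_self_eq_one_of_mul_eq_one _ _ B.cast_g_mul_a').2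

theorem cast_g_mul_g : (g : ZMod 4) * g = 1 :=
  (mul_self_eq_one_of_mul_eq_one _ _ B.cast_g_mul_a').1

theorem cast_b' : (b' : ZMod 4) = g * (g * b') := by
  rw [← mul_assoc, B.cast_g_mul_g, one_mul]

/-- For `b ≡ 2, 3` mod 4 the trace conditions already make all four numerators over 4 even. After
halving, the norm condition `A ≡ C` mod 2 gives the parities. -/
theorem exists_even_of_isIntegral (h2 : (g * b' : ZMod 4) = 2 ∨ (g * b' : ZMod 4) = 3)
    {y : L} (h : IsIntegral ℤ y) :
    ∃ P Q R S : ℤ, y = comb α β δ (P / 2) (Q / 2) (R / 2) (S / 2) ∧ 2 ∣ P - Q ∧ 2 ∣ R - S := by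
  obtain ⟨P, Q, R, S, A, C, rfl, h4, h5, h6, h7, h8, h9⟩ := B.exists_of_isIntegral h
  rw [four_dvd_iff] at h4 h5 h6 h9
  push_cast at h4 h5 h6 h9
  rw [B.cast_g_mul_a', one_mul] at h4 h9
  rw [B.cast_a'] at h6
  replace h4 := two_mul_sub_eq_zero_of_sq _ _ h4
  replace h9 := two_mul_sub_eq_zero_of_sq _ _ h9
  replace h5 := two_mul_eq_zero_of_sq _ _ _ h2 h5
  replace h6 := two_mul_eq_zero_of_sq _ _ _ h2 h6
  obtain ⟨h5, hR⟩ := h5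
  rw [mul_sub, h5, zero_sub, neg_eq_zero] at h4
  obtain ⟨P, rfl⟩ := (two_dvd_iff P).2 h5
  obtain ⟨Q, rfl⟩ := (two_dvd_iff Q).2 h4
  obtain ⟨R, rfl⟩ := (two_dvd_iff R).2 hR
  obtain ⟨S, rfl⟩ := (two_dvd_iff S).2 h6.2
  have h10 : P ^ 2 + g * a' * Q ^ 2 - g * b' * R ^ 2 - a' * b' * S ^ 2 = 2 * A := by linarith
  have h11 : P * Q - b' * R * S = C := by linarith
  replace h10 := congrArg (Int.cast : ℤ → ZMod 4) h10
  replace h11 := congrArg (Int.cast : ℤ → ZMod 4) h11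
  push_cast at h10 h11
  rw [B.cast_g_mul_a', one_mul, B.cast_a'] at h10
  have h12 := residues_even g (g * b') P Q R S B.cast_g_mul_g h2 (by
    rw [h10, ← B.cast_b', h11, ← sub_eq_zero, ← mul_sub, h9])
  refine ⟨P, Q, R, S, ?_, ?_, ?_⟩
  · congr 1 <;> push_cast <;> ring
  · rw [two_dvd_iff]; push_cast; exact h12.1
  · rw [two_dvd_iff]; push_cast; exact h12.2

theorem exists_of_isIntegral_of_one (h2 : (g * b' : ZMod 4) = 1)
    {y : L} (h : IsIntegral ℤ y) :
    ∃ P Q R S : ℤ, y = comb α β δ (P / 4) (Q / 4) (R / 4) (S / 4) ∧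
      2 ∣ P - Q ∧ 2 ∣ P - R ∧ 2 ∣ P - S ∧ 4 ∣ P + g * Q + R + S := by
  obtain ⟨P, Q, R, S, A, C, rfl, h4, h5, h6, h7, h8, h9⟩ := B.exists_of_isIntegral h
  have hb' : (b' : ZMod 4) = g := by rw [B.cast_b', h2, mul_one]
  rw [four_dvd_iff] at h4 h5 h6 h9
  push_cast at h4 h5 h6 h9
  rw [B.cast_g_mul_a', one_mul] at h4 h9
  rw [B.cast_a', h2, one_mul] at h6
  rw [h2, one_mul] at h5
  replace h4 := two_mul_sub_eq_zero_of_sq _ _ h4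
  replace h5 := two_mul_sub_eq_zero_of_sq _ _ h5
  replace h6 := two_mul_sub_eq_zero_of_sq _ _ h6
  replace h9 := two_mul_sub_eq_zero_of_sq _ _ h9
  refine ⟨P, Q, R, S, rfl, ?_, ?_, ?_, ?_⟩
  · rw [two_dvd_iff]; push_cast; exact h4
  · rw [two_dvd_iff]; push_cast; exact h5
  · rw [two_dvd_iff]; push_cast; exact h6
  rw [mul_sub, sub_eq_zero] at h4 h5 h6
  -- The four numerators share one parity. If even, they are halved and `A ≡ C` mod 2 is used; if
  -- odd, the divisibility of `P Q - b' R S` by 4 suffices.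
  by_cases hP : 2 * (P : ZMod 4) = 0
  · rw [hP] at h4 h5 h6
    obtain ⟨P, rfl⟩ := (two_dvd_iff P).2 hP
    obtain ⟨Q, rfl⟩ := (two_dvd_iff Q).2 h4.symm
    obtain ⟨R, rfl⟩ := (two_dvd_iff R).2 h5.symm
    obtain ⟨S, rfl⟩ := (two_dvd_iff S).2 h6.symm
    have h10 : P ^ 2 + g * a' * Q ^ 2 - g * b' * R ^ 2 - a' * b' * S ^ 2 = 2 * A := by linarith
    have h11 : P * Q - b' * R * S = C := by linarith
    replace h10 := congrArg (Int.cast : ℤ → ZMod 4) h10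
    replace h11 := congrArg (Int.cast : ℤ → ZMod 4) h11
    push_cast at h10 h11
    rw [B.cast_g_mul_a', one_mul, B.cast_a', h2, one_mul, one_mul] at h10
    have h12 := residues_sum_even g P Q R S B.cast_g_mul_g (by
      rw [h10, ← hb', h11, ← sub_eq_zero, ← mul_sub, h9])
    rw [four_dvd_iff]
    push_cast
    linear_combination h12
  · have h10 : P * Q - b' * R * S = 4 * C := by linarith
    replace h10 := congrArg (Int.cast : ℤ → ZMod 4) h10
    push_cast at h10
    rw [hb', show (4 : ZMod 4) = 0 from rfl, zero_mul] at h10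
    rw [four_dvd_iff]
    push_cast
    apply residues_all_odd _ _ _ _ _ B.cast_g_mul_g _ _ _ _ h10 <;>
      apply mul_self_eq_one_of_two_mul_ne_zero
    · exact hP
    · rwa [← h4]
    · rwa [← h5]
    · rwa [← h6]

theorem isIntegral_α_half : IsIntegral ℤ ((1 + α) / 2) :=
  isIntegral_half_one_add (by rw [B.sq_α]; push_cast; rfl) B.mod_four

theorem isIntegral_β : IsIntegral ℤ β := by
  apply IsIntegral.of_pow (n := 2) two_pos
  rw [B.sq_β]
  exact (isIntegral_intCast ..).mul (isIntegral_intCast ..)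

theorem isIntegral_β_add_δ_half : IsIntegral ℤ ((β + δ) / 2) := by
  apply IsIntegral.of_pow (n := 2) two_pos
  obtain ⟨m, hm⟩ : 4 ∣ g + a' - 2 := by
    rw [four_dvd_iff]
    push_cast
    rw [B.cast_a']
    have := B.cast_g_mul_g
    generalize (g : ZMod 4) = x at this
    decide +revert
  refine isIntegral_of_eq ((isIntegral_intCast (b' * m)).add
    ((isIntegral_intCast b').mul B.isIntegral_α_half)) ?_
  have hm' : (g : L) + a' - 2 = 4 * m := by exact_mod_cast hm
  push_cast
  linear_combination (-b' / 4 : L) * hm' - (1 / 4 : L) * B.sq_β - (1 / 4 : L) * B.sq_δ -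
    (1 / 2 : L) * B.β_mul_δ

/-- Such an element is an integral combination of `1`, `(1 + α) / 2`, `β` and `(β + δ) / 2`. -/
theorem isIntegral_comb_half {P Q R S : ℤ} (h1 : 2 ∣ P - Q) (h2 : 2 ∣ R - S) :
    IsIntegral ℤ (comb α β δ (P / 2) (Q / 2) (R / 2) (S / 2)) := by
  obtain ⟨m, hm⟩ := h1
  obtain ⟨n, hn⟩ := h2
  obtain rfl : P = Q + 2 * m := by linarith
  obtain rfl : R = S + 2 * n := by linarith
  refine isIntegral_of_eq ((((isIntegral_intCast m).add
    ((isIntegral_intCast Q).mul B.isIntegral_α_half)).add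
    ((isIntegral_intCast n).mul B.isIntegral_β)).add
    ((isIntegral_intCast S).mul B.isIntegral_β_add_δ_half)) ?_
  simp only [comb]
  push_cast
  ring

/-- Such an element is an integral combination of `1`, `(1 + α) / 2`, `(1 + β) / 2` and `(1 + β)(1 +
δ) / 4`. As `β δ = b' α`, the last one contributes `b'` to the numerator at `α`. -/
theorem isIntegral_comb_quarter (h : (g * b' : ZMod 4) = 1) {P Q R S : ℤ} (h1 : 2 ∣ P - Q)
    (h2 : 2 ∣ P - R) (h3 : 2 ∣ P - S) (h4 : 4 ∣ P + g * Q + R + S) :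
    IsIntegral ℤ (comb α β δ (P / 4) (Q / 4) (R / 4) (S / 4)) := by
  have hb' : (b' : ZMod 4) = g := by rw [B.cast_b', h, mul_one]
  have hb : g * b' ≡ 1 [ZMOD 4] := by
    refine (ZMod.intCast_eq_intCast_iff _ _ 4).1 ?_; push_cast; exact h
  have hk : a' * b' ≡ 1 [ZMOD 4] := by
    refine (ZMod.intCast_eq_intCast_iff _ _ 4).1 ?_; push_cast; rw [B.cast_a', h]
  have iβ : IsIntegral ℤ ((1 + β) / 2) :=
    isIntegral_half_one_add (by rw [B.sq_β]; push_cast; rfl) hb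
  have iδ : IsIntegral ℤ ((1 + δ) / 2) :=
    isIntegral_half_one_add (by rw [B.sq_δ]; push_cast; rfl) hk
  obtain ⟨x0, hx0⟩ : 4 ∣ P - Q - R + b' * S := by
    rw [two_dvd_iff] at h1 h2 h3
    rw [four_dvd_iff] at h4 ⊢
    push_cast at h1 h2 h3 h4 ⊢
    rw [hb']
    exact residues_sub _ _ _ _ _ B.cast_g_mul_g h1 h2 h3 h4
  obtain ⟨x1, hx1⟩ : 2 ∣ Q - b' * S := by
    have h5 : 2 ∣ b' - 1 := by
      rw [two_dvd_iff]
      push_cast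
      rw [hb']
      have := B.cast_g_mul_g
      generalize (g : ZMod 4) = x at this
      decide +revert
    have h6 := h5.mul_right S
    rw [sub_mul] at h6
    omega
  obtain ⟨x2, hx2⟩ : 2 ∣ R - S := by omega
  refine isIntegral_of_eq ((((isIntegral_intCast x0).add
    ((isIntegral_intCast x1).mul B.isIntegral_α_half)).add
    ((isIntegral_intCast x2).mul iβ)).add
    ((isIntegral_intCast S).mul (iβ.mul iδ))) ?_
  have hx0' : (P : L) - Q - R + b' * S = 4 * x0 := by exact_mod_cast hx0
  have hx1' : (Q : L) - b' * S = 2 * x1 := by exact_mod_cast hx1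
  have hx2' : (R : L) - S = 2 * x2 := by exact_mod_cast hx2
  simp only [comb]
  push_cast
  linear_combination (-1 / 4 : L) * hx0' - (1 + α) / 4 * hx1' - (1 + β) / 4 * hx2' +
    (S / 4 : L) * B.β_mul_δ

end Biquadratic
end Integrality
end HopfGalois

/-! ### The group N and the Hopf algebra H -/

namespace HopfGalois

section Klein

variable {G : Type*} [Group G]

open scoped Classical in
/-- The `4`-cycle `1 ↦ σ τ ↦ τ ↦ σ ↦ 1`. -/
noncomputable def fourCycle (σ τ : G) : Equiv.Perm G := List.formPerm [1, σ * τ, τ, σ]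

theorem fourCycle_σ (σ τ : G) : fourCycle σ τ σ = 1 := by
  simp [fourCycle, List.formPerm_cons_cons]

theorem fourCycle_inv_one (σ τ : G) : (fourCycle σ τ)⁻¹ 1 = σ := by
  rw [Equiv.Perm.inv_eq_iff_eq, fourCycle_σ]

/-- `σ` and `τ` generate `G`, which is elementary abelian of order four. -/
structure IsKleinPair (σ τ : G) : Prop where
  σ_σ : σ * σ = 1
  τ_τ : τ * τ = 1
  τ_σ : τ * σ = σ * τ
  τ_ne_one : τ ≠ 1
  σ_ne_one : σ ≠ 1
  σ_ne_τ : σ ≠ τ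
  exhaust : ∀ x : G, x = 1 ∨ x = σ ∨ x = τ ∨ x = σ * τ

namespace IsKleinPair

variable {σ τ : G} (k : IsKleinPair σ τ)
include k

theorem σ_τ_ne_one : σ * τ ≠ 1 := fun h => k.σ_ne_τ (by
  rw [eq_comm, ← mul_right_inj σ, h, k.σ_σ])

theorem σ_τ_ne_σ : σ * τ ≠ σ := fun h => k.τ_ne_one (by simpa using h)

theorem σ_τ_ne_τ : σ * τ ≠ τ := fun h => k.σ_ne_one (by simpa using h)

theorem fourCycle_one : fourCycle σ τ 1 = σ * τ := by
  simp [fourCycle, List.formPerm_cons_cons, Equiv.swap_apply_def, k.σ_τ_ne_one.symm,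
    k.σ_ne_one.symm, k.τ_ne_one.symm]

theorem fourCycle_σ_τ : fourCycle σ τ (σ * τ) = τ := by
  simp [fourCycle, List.formPerm_cons_cons, Equiv.swap_apply_def, k.σ_ne_one,
    k.τ_ne_one, k.σ_τ_ne_τ.symm]

theorem fourCycle_τ : fourCycle σ τ τ = σ := by
  simp [fourCycle, List.formPerm_cons_cons, Equiv.swap_apply_def,
    k.σ_ne_one, k.τ_ne_one, k.σ_ne_τ]

theorem τ_mul_σ_τ : τ * (σ * τ) = σ := by
  rw [← mul_assoc, k.τ_σ, mul_assoc, k.τ_τ, mul_one]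

theorem σ_mul_σ_τ : σ * (σ * τ) = τ := by
  rw [← mul_assoc, k.σ_σ, one_mul]

theorem perm_ext {f h : Equiv.Perm G} (h1 : f 1 = h 1) (h2 : f σ = h σ) (h3 : f τ = h τ)
    (h4 : f (σ * τ) = h (σ * τ)) : f = h := by
  ext x
  rcases k.exhaust x with rfl | rfl | rfl | rfl <;> assumption

theorem mulLeft_mul_mulLeft : Equiv.mulLeft τ * Equiv.mulLeft τ = 1 := by
  ext x
  simp [← mul_assoc, k.τ_τ]

theorem fourCycle_mul_fourCycle : fourCycle σ τ * fourCycle σ τ = Equiv.mulLeft τ := by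
  apply k.perm_ext <;>
    simp [k.fourCycle_one, fourCycle_σ, k.fourCycle_τ, k.fourCycle_σ_τ, k.τ_σ, k.τ_mul_σ_τ, k.τ_τ]

theorem fourCycle_mul_mulLeft :
    fourCycle σ τ * Equiv.mulLeft τ = Equiv.mulLeft τ * fourCycle σ τ := by
  rw [← k.fourCycle_mul_fourCycle, mul_assoc]

theorem conj_σ_fourCycle : MulAut.conj (Equiv.mulLeft σ) (fourCycle σ τ) =
    Equiv.mulLeft τ * fourCycle σ τ := by
  rw [MulAut.conj_apply, mul_inv_eq_iff_eq_mul]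
  apply k.perm_ext <;>
    simp [k.fourCycle_one, fourCycle_σ, k.fourCycle_τ, k.fourCycle_σ_τ, k.τ_σ, k.τ_mul_σ_τ,
      k.τ_τ, k.σ_σ, k.σ_mul_σ_τ]

theorem conj_τ_fourCycle : MulAut.conj (Equiv.mulLeft τ) (fourCycle σ τ) = fourCycle σ τ := by
  rw [MulAut.conj_apply, mul_inv_eq_iff_eq_mul, k.fourCycle_mul_mulLeft]

theorem conj_mulLeft (g : G) :
    MulAut.conj (Equiv.mulLeft g) (Equiv.mulLeft τ) = Equiv.mulLeft τ := by
  rw [MulAut.conj_apply, mul_inv_eq_iff_eq_mul]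
  ext x
  have : g * τ = τ * g := by
    rcases k.exhaust g with rfl | rfl | rfl | rfl
    · simp
    · exact k.τ_σ.symm
    · rfl
    · rw [k.τ_mul_σ_τ, mul_assoc, k.τ_τ, mul_one]
  simp [← mul_assoc, this]

theorem mulLeft_inv_one : (Equiv.mulLeft τ)⁻¹ 1 = τ := by
  rw [Equiv.Perm.inv_eq_iff_eq, Equiv.coe_mulLeft]
  exact k.τ_τ.symm

theorem mulLeft_mul_fourCycle_inv_one : (Equiv.mulLeft τ * fourCycle σ τ)⁻¹ 1 = σ * τ := by
  rw [Equiv.Perm.inv_eq_iff_eq, Equiv.Perm.mul_apply, k.fourCycle_σ_τ, Equiv.coe_mulLeft]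
  exact k.τ_τ.symm

/-- Since `η² = μ` and `μ² = 1`, the group is cyclic, generated by `η`, with `η³ = μ η`. -/
theorem mem_cyclicRegular {ν : Equiv.Perm G} : ν ∈ cyclicRegular σ τ ↔
    ν = 1 ∨ ν = Equiv.mulLeft τ ∨ ν = fourCycle σ τ ∨ ν = Equiv.mulLeft τ * fourCycle σ τ := by
  have hμ : Equiv.mulLeft τ ∈ cyclicRegular σ τ :=
    Subgroup.subset_closure (Set.mem_insert _ _)
  have hη : fourCycle σ τ ∈ cyclicRegular σ τ :=
    Subgroup.subset_closure (Set.mem_insert_of_mem _ rfl)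
  constructor
  · intro h
    have hle : cyclicRegular σ τ ≤ Subgroup.zpowers (fourCycle σ τ) := by
      rw [cyclicRegular, Subgroup.closure_le]
      rintro x (rfl | rfl)
      · rw [← k.fourCycle_mul_fourCycle]
        exact mul_mem (Subgroup.mem_zpowers _) (Subgroup.mem_zpowers _)
      · exact Subgroup.mem_zpowers _
    obtain ⟨n, rfl⟩ := Subgroup.mem_zpowers_iff.1 (hle h)
    have h2 : fourCycle σ τ ^ 2 = Equiv.mulLeft τ := by rw [sq, k.fourCycle_mul_fourCycle]
    have h4 : fourCycle σ τ ^ (4 : ℤ) = 1 := by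
      rw [show (4 : ℤ) = ((2 * 2 : ℕ) : ℤ) from rfl, zpow_natCast, pow_mul, h2, sq,
        k.mulLeft_mul_mulLeft]
    have hn : fourCycle σ τ ^ n = fourCycle σ τ ^ (n % 4) := by
      conv_lhs => rw [← Int.emod_add_mul_ediv n 4, zpow_add, zpow_mul, h4, one_zpow, mul_one]
    rw [hn]
    have : n % 4 = 0 ∨ n % 4 = 1 ∨ n % 4 = 2 ∨ n % 4 = 3 := by omega
    rcases this with h | h | h | h <;> rw [h]
    · simp
    · simp
    · exact Or.inr (Or.inl (by exact_mod_cast h2))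
    · refine Or.inr (Or.inr (Or.inr ?_))
      rw [← h2, ← pow_succ]
      rfl
  · rintro (rfl | rfl | rfl | rfl)
    · exact one_mem _
    · exact hμ
    · exact hη
    · exact mul_mem hμ hη

end IsKleinPair
end Klein

section Elements

variable {K L : Type*} [Field K] [Field L] [Algebra K L]

/-- The element `c₀ + c₁ μ + c₂ η + c₃ μ η` of `L[Perm G]`. -/
noncomputable def quadSum (σ τ : Gal(L/K)) (c₀ c₁ c₂ c₃ : L) :
    MonoidAlgebra L (Equiv.Perm Gal(L/K)) :=
  MonoidAlgebra.single 1 c₀ + MonoidAlgebra.single (Equiv.mulLeft τ) c₁ +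
    MonoidAlgebra.single (fourCycle σ τ) c₂ +
    MonoidAlgebra.single (Equiv.mulLeft τ * fourCycle σ τ) c₃

theorem twist_single (g : Gal(L/K)) (ν : Equiv.Perm Gal(L/K)) (c : L) :
    twist g (MonoidAlgebra.single ν c) =
      MonoidAlgebra.single (MulAut.conj (Equiv.mulLeft g) ν) (g c) := by
  simp [twist]

theorem twist_mul (g h : Gal(L/K)) (x : MonoidAlgebra L (Equiv.Perm Gal(L/K))) :
    twist (g * h) x = twist g (twist h x) := by
  induction x using MonoidAlgebra.induction_linear with
  | zero => simp
  | add x y hx hy => simp only [map_add, hx, hy]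
  | single ν c =>
    rw [twist_single, twist_single, twist_single, AlgEquiv.mul_apply]
    congr 1

namespace IsKleinPair

variable {σ τ : Gal(L/K)} (k : IsKleinPair σ τ)
include k

theorem actionLinear_quadSum (c₀ c₁ c₂ c₃ y : L) :
    actionLinear (quadSum σ τ c₀ c₁ c₂ c₃) y =
      c₀ * y + c₁ * τ y + c₂ * σ y + c₃ * σ (τ y) := by
  simp only [quadSum, map_add, LinearMap.add_apply, actionLinear_single, fourCycle_inv_one,
    k.mulLeft_inv_one, k.mulLeft_mul_fourCycle_inv_one, inv_one, Equiv.Perm.one_apply,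
    AlgEquiv.one_apply, AlgEquiv.mul_apply]

theorem quadSum_coeff (c₀ c₁ c₂ c₃ : L) :
    (quadSum σ τ c₀ c₁ c₂ c₃).coeff 1 = c₀ ∧
    (quadSum σ τ c₀ c₁ c₂ c₃).coeff (Equiv.mulLeft τ) = c₁ ∧
    (quadSum σ τ c₀ c₁ c₂ c₃).coeff (fourCycle σ τ) = c₂ ∧
    (quadSum σ τ c₀ c₁ c₂ c₃).coeff (Equiv.mulLeft τ * fourCycle σ τ) = c₃ := by
  classical
  -- The four permutations are told apart by where their inverses send `1`.
  have hne : ∀ {f h : Equiv.Perm Gal(L/K)}, f⁻¹ 1 ≠ h⁻¹ 1 → f ≠ h := fun h1 h2 => h1 (h2 ▸ rfl)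
  have h01 : (1 : Equiv.Perm Gal(L/K)) ≠ Equiv.mulLeft τ := hne (by
    rw [k.mulLeft_inv_one]; exact k.τ_ne_one.symm)
  have h02 : (1 : Equiv.Perm Gal(L/K)) ≠ fourCycle σ τ := hne (by
    rw [fourCycle_inv_one]; exact k.σ_ne_one.symm)
  have h03 : (1 : Equiv.Perm Gal(L/K)) ≠ Equiv.mulLeft τ * fourCycle σ τ := hne (by
    rw [k.mulLeft_mul_fourCycle_inv_one]; exact k.σ_τ_ne_one.symm)
  have h12 : Equiv.mulLeft τ ≠ fourCycle σ τ := hne (by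
    rw [k.mulLeft_inv_one, fourCycle_inv_one]; exact k.σ_ne_τ.symm)
  have h13 : Equiv.mulLeft τ ≠ Equiv.mulLeft τ * fourCycle σ τ := hne (by
    rw [k.mulLeft_inv_one, k.mulLeft_mul_fourCycle_inv_one]; exact k.σ_τ_ne_τ.symm)
  have h23 : fourCycle σ τ ≠ Equiv.mulLeft τ * fourCycle σ τ := hne (by
    rw [fourCycle_inv_one, k.mulLeft_mul_fourCycle_inv_one]; exact k.σ_τ_ne_σ.symm)
  simp only [quadSum, MonoidAlgebra.coeff_add, MonoidAlgebra.coeff_single, Finsupp.add_apply,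
    Finsupp.single_apply, if_true, h01, h02, h03, h12, h13, h23, h01.symm, h02.symm, h03.symm,
    h12.symm, h13.symm, h23.symm, if_false, add_zero, zero_add, and_self]

theorem quadSum_inj {c₀ c₁ c₂ c₃ d₀ d₁ d₂ d₃ : L}
    (h : quadSum σ τ c₀ c₁ c₂ c₃ = quadSum σ τ d₀ d₁ d₂ d₃) :
    c₀ = d₀ ∧ c₁ = d₁ ∧ c₂ = d₂ ∧ c₃ = d₃ := by
  have h1 := k.quadSum_coeff c₀ c₁ c₂ c₃
  rw [h] at h1
  have h2 := k.quadSum_coeff d₀ d₁ d₂ d₃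
  exact ⟨h1.1.symm.trans h2.1, h1.2.1.symm.trans h2.2.1, h1.2.2.1.symm.trans h2.2.2.1,
    h1.2.2.2.symm.trans h2.2.2.2⟩

theorem twist_σ_quadSum (c₀ c₁ c₂ c₃ : L) : twist σ (quadSum σ τ c₀ c₁ c₂ c₃) =
    quadSum σ τ (σ c₀) (σ c₁) (σ c₃) (σ c₂) := by
  simp only [quadSum, map_add, twist_single, map_one, k.conj_mulLeft, k.conj_σ_fourCycle,
    map_mul]
  rw [← mul_assoc, k.mulLeft_mul_mulLeft, one_mul]
  abel

theorem twist_τ_quadSum (c₀ c₁ c₂ c₃ : L) : twist τ (quadSum σ τ c₀ c₁ c₂ c₃) =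
    quadSum σ τ (τ c₀) (τ c₁) (τ c₂) (τ c₃) := by
  simp only [quadSum, map_add, twist_single, map_one, k.conj_mulLeft, k.conj_τ_fourCycle,
    map_mul]

/-- Conjugation by `σ` exchanges `η` and `μ η`, while conjugation by `τ` fixes all of `N`.
Invariance therefore puts the first two coefficients in the fixed field of `σ` and `τ`, the third in
that of `τ`, and makes the fourth its `σ`-conjugate. -/
theorem mem_hopfAlgebra {x : MonoidAlgebra L (Equiv.Perm Gal(L/K))} :
    x ∈ hopfAlgebra (cyclicRegular σ τ) ↔ ∃ c₀ c₁ c₂ : L, x = quadSum σ τ c₀ c₁ c₂ (σ c₂) ∧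
      σ c₀ = c₀ ∧ τ c₀ = c₀ ∧ σ c₁ = c₁ ∧ τ c₁ = c₁ ∧ τ c₂ = c₂ := by
  have hσσ : ∀ c : L, σ (σ c) = c := fun c => by
    rw [← AlgEquiv.mul_apply, k.σ_σ, AlgEquiv.one_apply]
  have hτσ : ∀ c : L, τ (σ c) = σ (τ c) := fun c => by
    rw [← AlgEquiv.mul_apply, k.τ_σ, AlgEquiv.mul_apply]
  have hrange : x ∈ (MonoidAlgebra.mapDomainAlgHom K L (cyclicRegular σ τ).subtype).range ↔
      ∃ c₀ c₁ c₂ c₃ : L, x = quadSum σ τ c₀ c₁ c₂ c₃ := by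
    constructor
    · rintro ⟨y, rfl⟩
      induction y using MonoidAlgebra.induction_linear with
      | zero => exact ⟨0, 0, 0, 0, by simp [quadSum]⟩
      | add y z hy hz =>
        obtain ⟨c₀, c₁, c₂, c₃, h⟩ := hy
        obtain ⟨d₀, d₁, d₂, d₃, h'⟩ := hz
        refine ⟨c₀ + d₀, c₁ + d₁, c₂ + d₂, c₃ + d₃, ?_⟩
        rw [map_add, h, h']
        simp only [quadSum, MonoidAlgebra.single_add]
        abel
      | single ν c =>
        obtain ⟨ν, hν⟩ := ν
        rcases k.mem_cyclicRegular.1 hν with rfl | rfl | rfl | rfl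
        · exact ⟨c, 0, 0, 0, by simp [quadSum]⟩
        · exact ⟨0, c, 0, 0, by simp [quadSum]⟩
        · exact ⟨0, 0, c, 0, by simp [quadSum]⟩
        · exact ⟨0, 0, 0, c, by simp [quadSum]⟩
    · rintro ⟨c₀, c₁, c₂, c₃, rfl⟩
      have hs : ∀ ν ∈ cyclicRegular σ τ, ∀ c : L, MonoidAlgebra.single ν c ∈
          (MonoidAlgebra.mapDomainAlgHom K L (cyclicRegular σ τ).subtype).range :=
        fun ν hν c => ⟨MonoidAlgebra.single ⟨ν, hν⟩ c, by simp⟩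
      refine add_mem (add_mem (add_mem ?_ ?_) ?_) ?_ <;> apply hs <;> rw [k.mem_cyclicRegular] <;>
        simp
  have hfix : x ∈ hopfAlgebra (cyclicRegular σ τ) ↔
      (x ∈ (MonoidAlgebra.mapDomainAlgHom K L (cyclicRegular σ τ).subtype).range) ∧
        twist σ x = x ∧ twist τ x = x := by
    rw [hopfAlgebra, Algebra.mem_inf, Algebra.mem_iInf]
    refine and_congr_right fun _ => ⟨fun h => ⟨h σ, h τ⟩, fun h g => ?_⟩
    change twist g x = x
    rcases k.exhaust g with rfl | rfl | rfl | rfl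
    · rw [← k.σ_σ, twist_mul, h.1, h.1]
    · exact h.1
    · exact h.2
    · rw [twist_mul, h.2, h.1]
  rw [hfix, hrange]
  constructor
  · rintro ⟨⟨c₀, c₁, c₂, c₃, rfl⟩, h1, h2⟩
    rw [k.twist_σ_quadSum] at h1
    rw [k.twist_τ_quadSum] at h2
    obtain ⟨h10, h11, -, rfl⟩ := k.quadSum_inj h1
    obtain ⟨h20, h21, h22, -⟩ := k.quadSum_inj h2
    exact ⟨c₀, c₁, c₂, rfl, h10, h20, h11, h21, h22⟩
  · rintro ⟨c₀, c₁, c₂, rfl, h10, h20, h11, h21, h22⟩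
    refine ⟨⟨_, _, _, _, rfl⟩, ?_, ?_⟩
    · rw [k.twist_σ_quadSum, h10, h11, hσσ]
    · rw [k.twist_τ_quadSum, h20, h21, hτσ, h22]

end IsKleinPair
end Elements
end HopfGalois

/-! ### The action of H in coordinates -/

namespace HopfGalois

section Action

variable {L : Type*} [Field L] [NumberField L]

/-- `f` is the endomorphism that acts on `1` by `u`, on `α` by `v`, and on the span of `β` and
`δ` by `w + z J`, where `J β = g δ` and `J δ = -a' β`. -/
def ActsBy (f : Module.End ℚ L) (g a' : ℤ) (α β δ : L) (u v w z : ℚ) : Prop :=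
  ∀ p q r s : ℚ, f (comb α β δ p q r s) =
    comb α β δ (u * p) (v * q) (w * r - z * a' * s) (w * s + z * g * r)

namespace Biquadratic

variable {g a' b' e : ℤ} {α β δ : L} {σ τ : Gal(L/ℚ)} (B : Biquadratic g a' b' e α β δ σ τ)
include B

theorem isKleinPair : IsKleinPair σ τ where
  σ_σ := B.σ_σ
  τ_τ := B.τ_τ
  τ_σ := B.τ_σ
  τ_ne_one := B.τ_ne_one
  σ_ne_one := B.σ_ne_one
  σ_ne_τ := B.σ_ne_τ
  exhaust φ := by
    have hα : φ α = α ∨ φ α = -α := by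
      apply sq_eq_sq_iff_eq_or_eq_neg.1
      rw [← map_pow, B.sq_α, map_mul, map_intCast, map_intCast]
    have hβ : φ β = β ∨ φ β = -β := by
      apply sq_eq_sq_iff_eq_or_eq_neg.1
      rw [← map_pow, B.sq_β, map_mul, map_intCast, map_intCast]
    have key : ∀ ψ : Gal(L/ℚ), φ α = ψ α → φ β = ψ β → φ = ψ := B.ext φ
    rcases hα with hα | hα <;> rcases hβ with hβ | hβ
    · exact Or.inl (key _ hα hβ)
    · exact Or.inr (Or.inr (Or.inl (key _ (by rw [hα, B.τ_α]) (by rw [hβ, B.τ_β]))))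
    · rcases B.sign with rfl | rfl
      · exact Or.inr (Or.inl (key _ (by rw [hα, B.σ_α]) (by rw [hβ, B.σ_β]; simp)))
      · exact Or.inr (Or.inr (Or.inr (key _ (by rw [hα, AlgEquiv.mul_apply, B.τ_α, B.σ_α])
          (by rw [hβ, AlgEquiv.mul_apply, B.τ_β, map_neg, B.σ_β]; simp))))
    · rcases B.sign with rfl | rfl
      · exact Or.inr (Or.inr (Or.inr (key _ (by rw [hα, AlgEquiv.mul_apply, B.τ_α, B.σ_α])
          (by rw [hβ, AlgEquiv.mul_apply, B.τ_β, map_neg, B.σ_β]; simp))))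
      · exact Or.inr (Or.inl (key _ (by rw [hα, B.σ_α]) (by rw [hβ, B.σ_β]; simp)))

/-- The part `s α (η - μ η)` acts as `s α σ (1 - τ)`: it kills `ℚ(α)` and is `2 e s J` on the plane
of `β` and `δ`. -/
theorem actsBy_quadSum (c₀ c₁ r s : ℚ) :
    ActsBy (actionLinear (quadSum σ τ (c₀ : L) c₁ (r + s * α) (σ (r + s * α)))) g a' α β δ
      (c₀ + c₁ + 2 * r) (c₀ + c₁ - 2 * r) (c₀ - c₁) (2 * e * s) := by
  intro p q t y
  rw [B.isKleinPair.actionLinear_quadSum, B.τ_comb, B.σ_comb, B.σ_comb]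
  simp only [map_add, map_mul, map_ratCast, B.σ_α, comb]
  push_cast
  linear_combination 2 * e * s * t * B.α_mul_β - 2 * e * s * y * B.α_mul_δ

theorem eq_ratCast_of_fixed {c : L} (h1 : σ c = c) (h2 : τ c = c) : ∃ p : ℚ, c = p := by
  obtain ⟨p, q, r, s, rfl⟩ := B.exists_eq_comb c
  rw [B.σ_comb] at h1
  rw [B.τ_comb] at h2
  obtain ⟨-, h, -, -⟩ := B.comb_inj h1
  obtain ⟨-, -, h3, h4⟩ := B.comb_inj h2
  refine ⟨p, ?_⟩
  rw [neg_eq_self.1 h, neg_eq_self.1 h3, neg_eq_self.1 h4]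
  simp [comb]

theorem eq_add_mul_of_fixed {c : L} (h2 : τ c = c) : ∃ p q : ℚ, c = p + q * α := by
  obtain ⟨p, q, r, s, rfl⟩ := B.exists_eq_comb c
  rw [B.τ_comb] at h2
  obtain ⟨-, -, h3, h4⟩ := B.comb_inj h2
  refine ⟨p, q, ?_⟩
  rw [neg_eq_self.1 h3, neg_eq_self.1 h4]
  simp [comb]

theorem exists_actsBy (h : hopfAlgebra (cyclicRegular σ τ)) :
    ∃ u v w z : ℚ, ActsBy (action (cyclicRegular σ τ) h) g a' α β δ u v w z ∧
      (u = 0 → v = 0 → w = 0 → z = 0 → h = 0) := by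
  obtain ⟨x, hx⟩ := h
  obtain ⟨c₀, c₁, c₂, rfl, h1, h2, h3, h4, h5⟩ := B.isKleinPair.mem_hopfAlgebra.1 hx
  obtain ⟨c₀, rfl⟩ := B.eq_ratCast_of_fixed h1 h2
  obtain ⟨c₁, rfl⟩ := B.eq_ratCast_of_fixed h3 h4
  obtain ⟨r, s, rfl⟩ := B.eq_add_mul_of_fixed h5
  refine ⟨_, _, _, _, B.actsBy_quadSum c₀ c₁ r s, fun hu hv hw hz => ?_⟩
  have he : (e : ℚ) ≠ 0 := by rcases B.sign with rfl | rfl <;> norm_num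
  obtain rfl : c₀ = 0 := by linarith
  obtain rfl : c₁ = 0 := by linarith
  obtain rfl : r = 0 := by linarith
  obtain rfl : s = 0 := by simpa [he] using hz
  apply Subtype.ext
  simp [quadSum]

theorem quadSum_mem_hopfAlgebra (c₀ c₁ r s : ℚ) :
    quadSum σ τ (c₀ : L) c₁ (r + s * α) (σ (r + s * α)) ∈ hopfAlgebra (cyclicRegular σ τ) :=
  B.isKleinPair.mem_hopfAlgebra.2 ⟨_, _, _, rfl, map_ratCast .., map_ratCast ..,
    map_ratCast .., map_ratCast .., by simp [B.τ_α]⟩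

/-- The coefficients solve the linear system of `actsBy_quadSum`; dividing by `2 e` is multiplying
by `e / 2`, because `e² = 1`. -/
theorem exists_hopf_actsBy (u v w z : ℚ) : ∃ h : hopfAlgebra (cyclicRegular σ τ),
    ActsBy (action (cyclicRegular σ τ) h) g a' α β δ u v w z := by
  have h := B.actsBy_quadSum ((u + v) / 4 + w / 2) ((u + v) / 4 - w / 2) ((u - v) / 4) (e * z / 2)
  refine ⟨⟨_, B.quadSum_mem_hopfAlgebra ((u + v) / 4 + w / 2) ((u + v) / 4 - w / 2) ((u - v) / 4)
    (e * z / 2)⟩, ?_⟩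
  convert h using 1
  · rfl
  · ring
  · ring
  · ring
  · have : (e : ℚ) * e = 1 := by rcases B.sign with rfl | rfl <;> norm_num
    linear_combination (-z) * this

end Biquadratic

theorem mem_nonclassicalOrder {σ τ : Gal(L/ℚ)} {h : hopfAlgebra (cyclicRegular σ τ)} :
    h ∈ nonclassicalOrder σ τ ↔
      ∀ y : L, IsIntegral ℤ y → IsIntegral ℤ (action (cyclicRegular σ τ) h y) := by
  constructor
  · intro hh y hy
    obtain ⟨z, hz⟩ := hh ⟨y, hy⟩
    change action (cyclicRegular σ τ) h y = z at hz
    rw [hz]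
    exact z.2
  · intro hh y
    exact ⟨⟨_, hh y y.2⟩, rfl⟩

end Action
end HopfGalois

/-! ### Freeness implies solvability -/

namespace HopfGalois

section Freeness

variable {K L H : Type*} [Field K] [Field L] [Algebra K L] [Ring H] [Algebra K H]
  {ρ : H →ₐ[K] Module.End K L}

theorem free_of_generator (θ : 𝓞 L) (h1 : ∀ y : 𝓞 L, ∃ h : associatedOrder ρ, h • θ = y)
    (h2 : ∀ h : associatedOrder ρ, h • θ = 0 → h = 0) :
    Module.Free (associatedOrder ρ) (𝓞 L) := by
  refine Module.Free.of_equiv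
    (LinearEquiv.ofBijective (LinearMap.toSpanSingleton (associatedOrder ρ) (𝓞 L) θ) ⟨?_, h1⟩)
  rw [← LinearMap.ker_eq_bot, LinearMap.ker_eq_bot']
  exact h2

/-- An element `E` sending `𝓞 L` into `ℤ` forces rank one: if `E b_i = n` and `E b_j = m` for
distinct basis elements, then `m E b_i = n E b_j`, so `m E = 0` and `m = 0`. By symmetry `E b_i = 0`
as well, contradicting freeness. -/
theorem exists_generator_of_free [CharZero L] (hf : Module.Free (associatedOrder ρ) (𝓞 L))
    (E : associatedOrder ρ) (hE : ∀ y : 𝓞 L, ∃ n : ℤ, E • y = (n : 𝓞 L))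
    (hE1 : E • (1 : 𝓞 L) ≠ 0) :
    ∃ θ : 𝓞 L, ∀ y : 𝓞 L, ∃ h : associatedOrder ρ, h • θ = y := by
  obtain ⟨ι, bs⟩ := hf
  have hint : ∀ (n : ℤ) (y : 𝓞 L), (n : associatedOrder ρ) • y = n * y := fun n y => by
    rw [Int.cast_smul_eq_zsmul, zsmul_eq_mul]
  have hE0 : E ≠ 0 := by
    rintro rfl
    exact hE1 (zero_smul _ _)
  have hnE : ∀ n : ℤ, (n : associatedOrder ρ) * E = 0 → n = 0 := by
    intro n hn
    have : ((n : associatedOrder ρ) * E) • (1 : 𝓞 L) = 0 := by rw [hn, zero_smul]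
    rw [mul_smul, hint] at this
    exact_mod_cast (mul_eq_zero.1 this).resolve_right hE1
  have hsub : ∀ i j : ι, i = j := by
    by_contra! ⟨i, j, hij⟩
    have key : ∀ i j : ι, i ≠ j → ∀ m : ℤ, E • bs j = (m : 𝓞 L) → m = 0 := by
      intro i j hij m hm
      obtain ⟨n, hn⟩ := hE (bs i)
      have h1 : ((m : associatedOrder ρ) * E) • bs i = ((n : associatedOrder ρ) * E) • bs j := by
        rw [mul_smul, mul_smul, hint, hint, hn, hm, mul_comm]
      have h2 := DFunLike.congr_fun (congrArg bs.repr h1) i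
      classical
      simp only [map_smul, Finsupp.smul_apply, Module.Basis.repr_self_apply, if_true,
        if_neg hij.symm, smul_eq_mul, mul_one, mul_zero] at h2
      exact hnE m h2
    obtain ⟨n, hn⟩ := hE (bs i)
    have h0 := key j i hij.symm n hn
    rw [h0, Int.cast_zero] at hn
    have h2 := congrArg bs.repr hn
    rw [map_smul, Module.Basis.repr_self, map_zero] at h2
    have h3 := DFunLike.congr_fun h2 i
    simp only [Finsupp.smul_apply, Finsupp.single_eq_same, smul_eq_mul, mul_one,
      Finsupp.zero_apply] at h3
    exact hE0 h3
  have : Subsingleton ι := ⟨hsub⟩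
  have hne : Nonempty ι := by
    by_contra hι
    rw [not_nonempty_iff] at hι
    have : E • (1 : 𝓞 L) = 0 := bs.repr.injective (Subsingleton.elim _ _)
    exact hE1 this
  obtain ⟨i⟩ := hne
  let _ : Unique ι := ⟨⟨i⟩, fun j => hsub _ _⟩
  refine ⟨bs i, fun y => ⟨bs.repr y i, ?_⟩⟩
  conv_rhs => rw [← bs.sum_repr y]
  rw [Fintype.sum_unique]
  rfl

end Freeness

section Order

variable {L : Type*} [Field L] [NumberField L]

namespace Biquadratic

variable {g a' b' e : ℤ} {α β δ : L} {σ τ : Gal(L/ℚ)} (B : Biquadratic g a' b' e α β δ σ τ)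
include B

theorem exists_trace : ∃ E : nonclassicalOrder σ τ,
    (∀ y : 𝓞 L, ∃ n : ℤ, E • y = (n : 𝓞 L)) ∧ E • (1 : 𝓞 L) ≠ 0 := by
  -- With `u = 4` and the other parameters zero, `E` is the trace from `L` to `ℚ`.
  obtain ⟨E, hE⟩ := B.exists_hopf_actsBy 4 0 0 0
  have key : ∀ y : L, IsIntegral ℤ y → ∃ n : ℤ, action (cyclicRegular σ τ) E y = n := by
    intro y hy
    obtain ⟨p, q, r, s, rfl⟩ := B.exists_eq_comb y
    obtain ⟨h1, h2, h3⟩ := B.isIntegral_conj hy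
    obtain ⟨n, hn⟩ := exists_int_of_isIntegral (L := L) (x := 4 * p)
      (isIntegral_of_eq ((hy.add h1).add (h2.add h3)) (by simp only [comb]; push_cast; ring))
    refine ⟨n, ?_⟩
    rw [hE, hn]
    simp [comb]
  refine ⟨⟨E, mem_nonclassicalOrder.2 fun y hy => ?_⟩, fun y => ?_, fun h => ?_⟩
  · obtain ⟨n, hn⟩ := key y hy
    rw [hn]
    exact isIntegral_intCast n
  · obtain ⟨n, hn⟩ := key y y.2
    refine ⟨n, RingOfIntegers.ext ?_⟩
    rw [coe_smul, hn]
    simp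
  · have h1 := congrArg (fun y : 𝓞 L => (y : L)) h
    simp only [coe_smul] at h1
    have h2 := hE 1 0 0 0
    rw [show comb α β δ 1 0 0 0 = ((1 : 𝓞 L) : L) by simp [comb], h1] at h2
    simp [comb] at h2

theorem cast_b_cases : (g * b' : ZMod 4) = 1 ∨ (g * b' : ZMod 4) = 2 ∨ (g * b' : ZMod 4) = 3 := by
  have h0 : (g * b' : ZMod 4) ≠ 0 := by
    intro h
    have h1 : 4 ∣ g * b' := by rw [four_dvd_iff]; push_cast; exact h
    have h2 : IsUnit (2 : ℤ) := B.squarefree_b 2 h1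
    rw [Int.isUnit_iff] at h2
    omega
  generalize (g * b' : ZMod 4) = x at h0
  decide +revert

theorem two_dvd_g_sub_one : 2 ∣ g - 1 := by
  rw [two_dvd_iff]
  push_cast
  have := B.cast_g_mul_g
  generalize (g : ZMod 4) = x at this
  decide +revert

theorem two_dvd_a'_sub_one : 2 ∣ a' - 1 := by
  rw [two_dvd_iff]
  push_cast
  rw [B.cast_a']
  have := B.cast_g_mul_g
  generalize (g : ZMod 4) = x at this
  decide +revert

/-- The components along `β` and `δ` of the algebraic integers. -/
theorem exists_denominator : ∃ t : ℚ, t ≠ 0 ∧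
    (∀ p q r s : ℚ, IsIntegral ℤ (comb α β δ p q r s) →
      ∃ R S : ℤ, r = R / (2 * t) ∧ s = S / (2 * t) ∧ 2 ∣ R - S) ∧
    (∃ p q : ℚ, IsIntegral ℤ (comb α β δ p q (1 / t) 0)) ∧
    (∃ p q : ℚ, IsIntegral ℤ (comb α β δ p q (1 / (2 * t)) (1 / (2 * t)))) ∧
    ∀ r s : ℚ, IsIntegral ℤ (comb α β δ 0 0 r s) →
      ∃ R S : ℤ, r = R / 2 ∧ s = S / 2 ∧ 2 ∣ R - S := by
  -- The projection of `𝓞 L` to the plane is `M / t`, with `t = 2` when `b ≡ 1` mod 4 and `t = 1`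
  -- otherwise; the integers inside the plane form `M` in both cases.
  rcases B.cast_b_cases with h | h
  · refine ⟨2, two_ne_zero, fun p q r s hy => ?_, ⟨(2 : ℤ) / 4, (0 : ℤ) / 4, ?_⟩,
      ⟨(1 : ℤ) / 4, (g : ℤ) / 4, ?_⟩, fun r s hy => ?_⟩
    · obtain ⟨P, Q, R, S, hy, h1, h2, h3, h4⟩ := B.exists_of_isIntegral_of_one h hy
      obtain ⟨-, -, rfl, rfl⟩ := B.comb_inj hy
      exact ⟨R, S, by ring, by ring, by omega⟩
    · have := B.isIntegral_comb_quarter h (P := 2) (Q := 0) (R := 2) (S := 0)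
        (by norm_num) (by norm_num) (by norm_num) (by norm_num)
      convert this using 2 <;> norm_num
    · have h2 := B.two_dvd_g_sub_one
      have := B.isIntegral_comb_quarter h (P := 1) (Q := g) (R := 1) (S := 1)
        (by omega) (by norm_num) (by norm_num) (by
          rw [four_dvd_iff]; push_cast; rw [B.cast_g_mul_g]; rfl)
      convert this using 2 <;> norm_num
    · obtain ⟨P, Q, R, S, hy, h1, h2, h3, h4⟩ := B.exists_of_isIntegral_of_one h hy
      obtain ⟨hP, hQ, rfl, rfl⟩ := B.comb_inj hy
      obtain rfl : P = 0 := by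
        have : (P : ℚ) = 0 := by linarith
        exact_mod_cast this
      obtain rfl : Q = 0 := by
        have : (Q : ℚ) = 0 := by linarith
        exact_mod_cast this
      rw [mul_zero] at h4
      obtain ⟨m, rfl⟩ : 2 ∣ R := by omega
      obtain ⟨n, rfl⟩ : 2 ∣ S := by omega
      exact ⟨m, n, by push_cast; ring, by push_cast; ring, by omega⟩
  · refine ⟨1, one_ne_zero, fun p q r s hy => ?_, ⟨0, 0, ?_⟩, ⟨0, 0, ?_⟩, fun r s hy => ?_⟩
    · obtain ⟨P, Q, R, S, hy, h1, h2⟩ := B.exists_even_of_isIntegral h hy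
      obtain ⟨-, -, rfl, rfl⟩ := B.comb_inj hy
      exact ⟨R, S, by ring, by ring, h2⟩
    · exact isIntegral_of_eq B.isIntegral_β (by simp [comb])
    · exact isIntegral_of_eq B.isIntegral_β_add_δ_half (by simp [comb]; ring)
    · obtain ⟨P, Q, R, S, hy, h1, h2⟩ := B.exists_even_of_isIntegral h hy
      obtain ⟨-, -, rfl, rfl⟩ := B.comb_inj hy
      exact ⟨R, S, rfl, rfl, h2⟩

/-- The leading and final coefficients of the norm form `2 g x² + 2 g x y + c y²`. -/
theorem exists_coprime : ∃ c : ℤ, g + a' = 2 * c ∧ IsCoprime (2 * g) c := by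
  obtain ⟨n, hn⟩ : 4 ∣ g + a' - 2 := by
    rw [four_dvd_iff]
    push_cast
    rw [B.cast_a']
    have := B.cast_g_mul_g
    generalize (g : ZMod 4) = x at this
    decide +revert
  have hc : g + a' = 2 * (2 * n + 1) := by linarith
  refine ⟨2 * n + 1, hc, IsCoprime.mul_left ⟨-n, 1, by ring⟩ ?_⟩
  have h1 : IsCoprime g a' := (squarefree_mul_iff.1 B.squarefree_a).1.isCoprime
  obtain ⟨x, y, hxy⟩ := h1
  refine ⟨x - y, 2 * y, ?_⟩
  linear_combination hxy - y * hc

/-- Elements of the order preserve the integers lying in the plane. Testing on `β` and on `(β + δ) /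
2` shows that `2 g z` and `c z` are integers, with `c = (g + a') / 2` coprime to `2 g`; so `z`, and
then `w`, is an integer. -/
theorem exists_int_of_mem {h : hopfAlgebra (cyclicRegular σ τ)} (hh : h ∈ nonclassicalOrder σ τ)
    {u v w z : ℚ} (hact : ActsBy (action (cyclicRegular σ τ) h) g a' α β δ u v w z) :
    ∃ W Z : ℤ, w = W ∧ z = Z := by
  rw [mem_nonclassicalOrder] at hh
  obtain ⟨t, -, -, -, -, hV⟩ := B.exists_denominator
  have h1 := hh _ (isIntegral_of_eq (y := comb α β δ 0 0 1 0) B.isIntegral_β (by simp [comb]))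
  have h2 := hh _ (isIntegral_of_eq (y := comb α β δ 0 0 (1 / 2) (1 / 2))
    B.isIntegral_β_add_δ_half (by simp [comb]; ring))
  rw [hact, mul_zero, mul_zero] at h1 h2
  obtain ⟨R, S, hR, hS, k, hk⟩ := hV _ _ h1
  obtain ⟨R', S', hR', hS', m, hm⟩ := hV _ _ h2
  obtain ⟨c, hc, x, y, hxy⟩ := B.exists_coprime
  have hcq : (g : ℚ) + a' = 2 * c := by exact_mod_cast hc
  have hxyq : (x : ℚ) * (2 * g) + y * c = 1 := by exact_mod_cast hxy
  have hmq : (R' : ℚ) - S' = 2 * m := by exact_mod_cast hm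
  have hkq : (R : ℚ) - S = 2 * k := by exact_mod_cast hk
  have hz : z = (x * S - y * m : ℤ) := by
    push_cast
    have e1 : z * c = -m := by linear_combination hS' - hR' - (1 / 2 : ℚ) * hmq - z / 2 * hcq
    have e2 : z * (2 * g) = S := by linear_combination 2 * hS
    linear_combination -z * hxyq + x * e2 + y * e1
  have hw : w = ((x * S - y * m) * g + k : ℤ) := by
    push_cast at hz ⊢
    linear_combination hR - hS + (1 / 2 : ℚ) * hkq + g * hz
  exact ⟨_, _, hw, hz⟩

theorem solvable_of_generator {θ : 𝓞 L}
    (hθ : ∀ y : 𝓞 L, ∃ h : nonclassicalOrder σ τ, h • θ = y) :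
    ∃ F X Y : ℤ, (F = 1 ∨ F = -1) ∧ X ^ 2 + g * a' * Y ^ 2 = 2 * g * F := by
  obtain ⟨t, ht, hV, ⟨p₁, q₁, h1⟩, ⟨p₂, q₂, h2⟩, -⟩ := B.exists_denominator
  obtain ⟨p, q, r, s, hy⟩ := B.exists_eq_comb (θ : L)
  obtain ⟨R, S, rfl, rfl, n, hn⟩ := hV p q r s (hy ▸ θ.2)
  have key : ∀ p' q' r' s' : ℚ, IsIntegral ℤ (comb α β δ p' q' (r' / (2 * t)) (s' / (2 * t))) →
      ∃ w z : ℤ, w * R - z * a' * S = r' ∧ w * S + z * g * R = s' := by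
    intro p' q' r' s' hi
    obtain ⟨h, hh⟩ := hθ ⟨_, hi⟩
    obtain ⟨u, v, w, z, hact, -⟩ := B.exists_actsBy (h : hopfAlgebra (cyclicRegular σ τ))
    obtain ⟨w, z, rfl, rfl⟩ := B.exists_int_of_mem h.2 hact
    have hh' := congrArg (fun y : 𝓞 L => (y : L)) hh
    simp only [coe_smul] at hh'
    rw [hy, hact] at hh'
    obtain ⟨-, -, h3, h4⟩ := B.comb_inj hh'
    refine ⟨w, z, ?_, ?_⟩
    · field_simp at h3
      linear_combination h3
    · field_simp at h4
      linear_combination h4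
  -- The two targets `(2, 0)` and `(1, 1)` generate the lattice of pairs with `R ≡ S` mod 2.
  obtain ⟨w, z, e1, e2⟩ := key p₁ q₁ 2 0 (by
    convert h1 using 2
    · field_simp
    · simp)
  obtain ⟨w', z', e3, e4⟩ := key p₂ q₂ 1 1 h2
  have e1' : w * R - z * a' * S = 2 := by exact_mod_cast e1
  have e2' : w * S + z * g * R = 0 := by exact_mod_cast e2
  have e3' : w' * R - z' * a' * S = 1 := by exact_mod_cast e3
  have e4' : w' * S + z' * g * R = 1 := by exact_mod_cast e4
  clear e1 e2 e3 e4
  obtain ⟨c, hc, hcop⟩ := B.exists_coprime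
  obtain rfl : R = S + 2 * n := by linarith
  -- `F` is half of `g R² + a' S²` at the generator. The form is multiplied by `w² + g a' z²` under
  -- `w + z J`, so `F` divides its half-values `2 g` at `(2, 0)` and `c` at `(1, 1)`.
  obtain ⟨F, hF⟩ : ∃ F, F = c * S ^ 2 + 2 * g * n * S + 2 * g * n ^ 2 := ⟨_, rfl⟩
  have hF2 : g * (S + 2 * n) ^ 2 + a' * S ^ 2 = 2 * F := by
    linear_combination S ^ 2 * hc - 2 * hF
  have d1 : F ∣ 2 * g := by
    refine ⟨w ^ 2 + g * a' * z ^ 2, ?_⟩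
    have : 2 * (2 * g) = 2 * (F * (w ^ 2 + g * a' * z ^ 2)) := by
      rw [← mul_assoc 2 F, ← hF2]
      linear_combination (-g * (w * (S + 2 * n) - z * a' * S + 2)) * e1' -
        a' * (w * S + z * g * (S + 2 * n)) * e2'
    linarith
  have d2 : F ∣ c := by
    refine ⟨w' ^ 2 + g * a' * z' ^ 2, ?_⟩
    have : 2 * c = 2 * (F * (w' ^ 2 + g * a' * z' ^ 2)) := by
      rw [← mul_assoc 2 F, ← hF2]
      linear_combination (-g * (w' * (S + 2 * n) - z' * a' * S + 1)) * e3' -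
        a' * (w' * S + z' * g * (S + 2 * n) + 1) * e4' - hc
    linarith
  have hunit := hcop.isUnit_of_dvd' d1 d2
  rw [Int.isUnit_iff] at hunit
  exact ⟨F, g * (S + 2 * n), S, hunit, by linear_combination g * hF2⟩

end Biquadratic
end Order
end HopfGalois

/-! ### Solvability implies freeness -/

namespace HopfGalois

section Residues

theorem residues_action : ∀ g : ZMod 4, g * g = 1 → ∀ P R S : ZMod 4, 2 * (P - R) = 0 →
    2 * (P - S) = 0 → ∀ X, X * X = 1 → ∀ Y, Y * Y = 1 →
    P + (P + R + S) * (1 + X + Y) + (g * R * X + g * S * Y) = 0 ∧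
      2 * P = g * R * X + g * S * Y + (S * X - R * Y) ∧ 2 * (g * R * X + g * S * Y) = 0 := by
  decide

theorem residues_twisted : ∀ g P Q R S : ZMod 4, g * g = 1 → 2 * (P - Q) = 0 → 2 * (P - R) = 0 →
    2 * (P - S) = 0 → P + g * Q + R + S = 0 →
    P - g * Q + g * (R - S) = 0 ∧ 2 * (P - g * Q) = 0 := by
  decide

theorem residues_mul : ∀ x y : ZMod 4, 2 * x = 0 → 2 * y = 0 → x * y = 0 := by
  decide

theorem residues_norm : ∀ g X Y : ZMod 4, g * g = 1 → g * X ^ 2 + g * Y ^ 2 = 2 →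
    X * X = 1 ∧ Y * Y = 1 := by
  decide

theorem residues_sign : ∀ g X Y : ZMod 4, g * g = 1 → X * X = 1 → Y * Y = 1 →
    1 + g + X + Y = 0 ∨ 1 - g + X + Y = 0 := by
  decide

theorem two_mul_eq_two_of_mul_self : ∀ g : ZMod 4, g * g = 1 → 2 * g = 2 := by
  decide

end Residues

section Order

variable {L : Type*} [Field L] [NumberField L]

namespace Biquadratic

variable {g a' b' e : ℤ} {α β δ : L} {σ τ : Gal(L/ℚ)} (B : Biquadratic g a' b' e α β δ σ τ)
include B

theorem mem_order_of_even (hb : (g * b' : ZMod 4) = 2 ∨ (g * b' : ZMod 4) = 3)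
    {h : hopfAlgebra (cyclicRegular σ τ)} {u v w z : ℤ}
    (hact : ActsBy (action (cyclicRegular σ τ) h) g a' α β δ u v w z) (huv : 2 ∣ u - v) :
    h ∈ nonclassicalOrder σ τ := by
  refine mem_nonclassicalOrder.2 fun y hy => ?_
  obtain ⟨P, Q, R, S, rfl, h1, h2⟩ := B.exists_even_of_isIntegral hb hy
  rw [hact]
  have := B.isIntegral_comb_half (P := u * P) (Q := v * Q) (R := w * R - z * a' * S)
    (S := w * S + z * g * R) (by
      rw [show u * P - v * Q = (u - v) * P + v * (P - Q) by ring]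
      exact dvd_add (huv.mul_right _) (h1.mul_left _)) (by
      rw [show w * R - z * a' * S - (w * S + z * g * R) =
        w * (R - S) - z * S * (a' - 1) - z * R * (g - 1) - z * (R - S) - 2 * (z * S) by ring]
      exact dvd_sub (dvd_sub (dvd_sub (dvd_sub (h2.mul_left _) (B.two_dvd_a'_sub_one.mul_left _))
        (B.two_dvd_g_sub_one.mul_left _)) (h2.mul_left _)) (Dvd.intro _ rfl))
  convert this using 2 <;> push_cast <;> ring

/-- These congruences are what carries the quarter-integral description of `𝓞 L` into itself. Only
their sufficiency is needed, to recognise the quotients built in `free_of_norm_form`. -/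
theorem mem_order_of_one (hb : (g * b' : ZMod 4) = 1)
    {h : hopfAlgebra (cyclicRegular σ τ)} {u v w z : ℤ}
    (hact : ActsBy (action (cyclicRegular σ τ) h) g a' α β δ u v w z) (huv : 2 ∣ u - v)
    (huw : 2 ∣ u - w - z) (huvw : 4 ∣ u + v + 2 * w) :
    h ∈ nonclassicalOrder σ τ := by
  refine mem_nonclassicalOrder.2 fun y hy => ?_
  obtain ⟨P, Q, R, S, rfl, h1, h2, h3, h4⟩ := B.exists_of_isIntegral_of_one hb hy
  rw [hact]
  have hg := two_mul_eq_two_of_mul_self _ B.cast_g_mul_g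
  have four : (4 : ZMod 4) = 0 := rfl
  have := B.isIntegral_comb_quarter hb (P := u * P) (Q := v * Q) (R := w * R - z * a' * S)
    (S := w * S + z * g * R)
  rw [two_dvd_iff] at h1 h2 h3 huv huw this
  rw [two_dvd_iff, two_dvd_iff] at this
  rw [four_dvd_iff] at h4 huvw this
  push_cast at h1 h2 h3 huv huw h4 huvw this
  rw [B.cast_a'] at this
  obtain ⟨h5, h6⟩ := residues_twisted _ _ _ _ _ B.cast_g_mul_g h1 h2 h3 h4
  have h7 := residues_mul _ _ huw h6
  refine isIntegral_of_eq (this ?_ ?_ ?_ ?_) ?_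
  · linear_combination (P : ZMod 4) * huv + v * h1
  · linear_combination (P : ZMod 4) * huw + w * h2 + z * S * hg - z * h3 + z * P * four
  · linear_combination (P : ZMod 4) * huw + w * h3 - z * R * hg + z * h2
  · linear_combination (w : ZMod 4) * h4 + g * Q * huvw + h7 + z * h5 - w * g * Q * four
  · simp only [comb]
    push_cast
    ring

theorem eq_zero_of_smul_eq_zero {θ : 𝓞 L} {p q r s : ℚ} (hθ : (θ : L) = comb α β δ p q r s)
    (hp : p ≠ 0) (hq : q ≠ 0) (hrs : g * r ^ 2 + a' * s ^ 2 ≠ 0) (h : nonclassicalOrder σ τ)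
    (hh : h • θ = 0) : h = 0 := by
  obtain ⟨u, v, w, z, hact, h0⟩ := B.exists_actsBy (h : hopfAlgebra (cyclicRegular σ τ))
  have hh' := congrArg (fun y : 𝓞 L => (y : L)) hh
  simp only [coe_smul] at hh'
  rw [hθ, hact] at hh'
  obtain ⟨h1, h2, h3, h4⟩ := B.comb_eq_zero (hh'.trans (by simp))
  apply Subtype.ext
  have hg : (g : ℚ) ≠ 0 := by exact_mod_cast B.g_pos.ne'
  have hz : z = 0 := by
    apply (mul_eq_zero.1 (_ : z * (g * r ^ 2 + a' * s ^ 2) = 0)).resolve_right hrs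
    linear_combination r * h4 - s * h3
  have hw : w = 0 := by
    apply (mul_eq_zero.1 (_ : w * (g * r ^ 2 + a' * s ^ 2) = 0)).resolve_right hrs
    linear_combination g * r * h3 + a' * s * h4
  exact h0 ((mul_eq_zero.1 h1).resolve_right hp) ((mul_eq_zero.1 h2).resolve_right hq) hw hz

/-- The generator has numerators `±1` at `1` and `α`, and `(X, Y)` in the plane. Any integer is
divided by it blockwise; in the plane this uses the conjugate of `(X, Y)` and the form value `2 F`,
with `F⁻¹ = F`. -/
theorem free_of_norm_form {F X Y : ℤ} (hF : F = 1 ∨ F = -1)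
    (h : g * X ^ 2 + a' * Y ^ 2 = 2 * F) : Module.Free (nonclassicalOrder σ τ) (𝓞 L) := by
  have hF2 : F * F = 1 := by rcases hF with rfl | rfl <;> norm_num
  have hFq : (F : ℚ) * F = 1 := by exact_mod_cast hF2
  have hq : (g : ℚ) * X ^ 2 + a' * Y ^ 2 = 2 * F := by exact_mod_cast h
  have hF0 : (F : ℚ) ≠ 0 := by rintro h; simp [h] at hFq
  have h4 : (g * X ^ 2 + g * Y ^ 2 : ZMod 4) = 2 := by
    have := congrArg (Int.cast : ℤ → ZMod 4) h
    push_cast at this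
    rw [B.cast_a'] at this
    rw [this]
    rcases hF with rfl | rfl <;> rfl
  have hgg := B.cast_g_mul_g
  obtain ⟨hX, hY⟩ := residues_norm _ _ _ hgg h4
  have hg1 := B.two_dvd_g_sub_one
  have ha1 := B.two_dvd_a'_sub_one
  have hX1 : 2 ∣ X - 1 := by
    rw [two_dvd_iff]; push_cast; rw [mul_sub, two_mul_eq_two_of_mul_self _ hX]; rfl
  have hY1 : 2 ∣ Y - 1 := by
    rw [two_dvd_iff]; push_cast; rw [mul_sub, two_mul_eq_two_of_mul_self _ hY]; rfl
  -- Because `g`, `a'`, `X` and `Y` are odd, the factor 2 in the form value cancels, leaving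
  -- integral `w = F W` and `z = F Z`.
  have hwz : ∀ R S : ℤ, 2 ∣ R - S → ∃ W Z : ℤ, g * R * X + a' * S * Y = 2 * W ∧
      S * X - R * Y = 2 * Z := by
    rintro R S ⟨n, hn⟩
    obtain ⟨g₁, hg₁⟩ := hg1
    obtain ⟨a₁, ha₁⟩ := ha1
    obtain ⟨x, hx⟩ := hX1
    obtain ⟨y, hy⟩ := hY1
    obtain rfl : g = 2 * g₁ + 1 := by linarith
    obtain rfl : a' = 2 * a₁ + 1 := by linarith
    obtain rfl : X = 2 * x + 1 := by linarith
    obtain rfl : Y = 2 * y + 1 := by linarith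
    obtain rfl : R = S + 2 * n := by linarith
    exact ⟨g₁ * (S + 2 * n) * (2 * x + 1) + n * (2 * x + 1) + S * x + S * (1 + y) +
      a₁ * S * (2 * y + 1), S * x - S * y - n * (2 * y + 1), by ring, by ring⟩
  rcases B.cast_b_cases with hb | hb
  -- The sign `κ` makes `(1 + κ α + X β + Y δ) / 4` integral, which requires `4 ∣ 1 + g κ + X + Y`.
  · obtain ⟨κ, hκ, hκs⟩ : ∃ κ : ℤ, κ * κ = 1 ∧ (1 + g * κ + X + Y : ZMod 4) = 0 := by
      rcases residues_sign _ _ _ hgg hX hY with hs | hs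
      · exact ⟨1, by norm_num, by push_cast; rw [mul_one]; exact hs⟩
      · exact ⟨-1, by norm_num, by push_cast; rw [mul_neg_one, ← sub_eq_add_neg]; exact hs⟩
    have hκq : (κ : ℚ) * κ = 1 := by exact_mod_cast hκ
    have hκ0 : (κ : ℚ) ≠ 0 := by rintro h; simp [h] at hκq
    have hκ1 : 2 ∣ 1 - κ := by
      rcases mul_self_eq_one_iff.1 hκ with rfl | rfl <;> norm_num
    have hint : IsIntegral ℤ (comb α β δ ((1 : ℤ) / 4) (κ / 4) (X / 4) (Y / 4)) :=
      B.isIntegral_comb_quarter hb hκ1 (by omega) (by omega) (by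
        rw [four_dvd_iff]; push_cast; exact hκs)
    refine free_of_generator ⟨_, hint⟩ ?_ (B.eq_zero_of_smul_eq_zero rfl (by norm_num)
      (by simpa using hκ0) (by
        rw [show (g : ℚ) * (X / 4) ^ 2 + a' * (Y / 4) ^ 2 = F / 8 by linear_combination hq / 16]
        simpa using hF0))
    rintro ⟨y, hy⟩
    obtain ⟨P, Q, R, S, rfl, h1, h2, h3, h5⟩ := B.exists_of_isIntegral_of_one hb hy
    obtain ⟨W, Z, hW, hZ⟩ := hwz R S (by omega)
    have hWq : (g : ℚ) * R * X + a' * S * Y = 2 * W := by exact_mod_cast hW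
    have hZq : (S : ℚ) * X - R * Y = 2 * Z := by exact_mod_cast hZ
    obtain ⟨h, hact⟩ := B.exists_hopf_actsBy (P : ℤ) (κ * Q : ℤ) (F * W : ℤ) (F * Z : ℤ)
    have hW4 : (g : ZMod 4) * R * X + g * S * Y = 2 * W := by
      have := congrArg (Int.cast : ℤ → ZMod 4) hW
      push_cast at this
      rwa [B.cast_a'] at this
    have hZ4 : (S : ZMod 4) * X - R * Y = 2 * Z := by
      have := congrArg (Int.cast : ℤ → ZMod 4) hZ
      push_cast at this
      exact this
    have hF4 : 2 * (F : ZMod 4) = 2 := by rcases hF with rfl | rfl <;> rfl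
    have hmem : h ∈ nonclassicalOrder σ τ := by
      have h2' := (two_dvd_iff _).1 h2
      have h3' := (two_dvd_iff _).1 h3
      rw [four_dvd_iff] at h5
      push_cast at h2' h3' h5
      obtain ⟨r1, r2, r3⟩ := residues_action _ hgg P R S h2' h3' X hX Y hY
      rw [hW4] at r1 r2 r3
      rw [hZ4] at r2
      refine B.mem_order_of_one hb hact ?_ ?_ ?_
      · rw [show P - κ * Q = (P - Q) + (1 - κ) * Q by ring]
        exact dvd_add h1 (hκ1.mul_right _)
      · rw [two_dvd_iff]
        push_cast
        linear_combination r2 - (W + Z : ZMod 4) * hF4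
      · rw [four_dvd_iff]
        push_cast
        linear_combination r1 + (W : ZMod 4) * hF4 + (κ : ZMod 4) * g * h5 -
          (P + R + S : ZMod 4) * hκs - (κ : ZMod 4) * Q * hgg
    refine ⟨⟨h, hmem⟩, RingOfIntegers.ext ?_⟩
    change action _ h (comb α β δ _ _ _ _) = comb α β δ _ _ _ _
    rw [hact]
    congr 1
    · push_cast; ring
    · push_cast; linear_combination Q / 4 * hκq
    · push_cast
      linear_combination (-F * X / 8 : ℚ) * hWq + (F * a' * Y / 8 : ℚ) * hZq + (F * R / 8 : ℚ) * hq +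
        (R / 4 : ℚ) * hFq
    · push_cast
      linear_combination (-F * Y / 8 : ℚ) * hWq - (F * g * X / 8 : ℚ) * hZq + (F * S / 8 : ℚ) * hq +
        (S / 4 : ℚ) * hFq
  · have hint : IsIntegral ℤ (comb α β δ ((1 : ℤ) / 2) ((1 : ℤ) / 2) (X / 2) (Y / 2)) :=
      B.isIntegral_comb_half (by norm_num) (by omega)
    refine free_of_generator ⟨_, hint⟩ ?_ (B.eq_zero_of_smul_eq_zero rfl (by norm_num)
      (by norm_num) (by
        rw [show (g : ℚ) * (X / 2) ^ 2 + a' * (Y / 2) ^ 2 = F / 2 by linear_combination hq / 4]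
        simpa using hF0))
    rintro ⟨y, hy⟩
    obtain ⟨P, Q, R, S, rfl, h1, h2⟩ := B.exists_even_of_isIntegral hb hy
    obtain ⟨W, Z, hW, hZ⟩ := hwz R S h2
    have hWq : (g : ℚ) * R * X + a' * S * Y = 2 * W := by exact_mod_cast hW
    have hZq : (S : ℚ) * X - R * Y = 2 * Z := by exact_mod_cast hZ
    obtain ⟨h, hact⟩ := B.exists_hopf_actsBy (P : ℤ) (Q : ℤ) (F * W : ℤ) (F * Z : ℤ)
    refine ⟨⟨h, B.mem_order_of_even hb hact h1⟩, RingOfIntegers.ext ?_⟩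
    change action _ h (comb α β δ _ _ _ _) = comb α β δ _ _ _ _
    rw [hact]
    congr 1
    · push_cast; ring
    · push_cast; ring
    · push_cast
      linear_combination (-F * X / 4 : ℚ) * hWq + (F * a' * Y / 4 : ℚ) * hZq + (F * R / 4 : ℚ) * hq +
        (R / 2 : ℚ) * hFq
    · push_cast
      linear_combination (-F * Y / 4 : ℚ) * hWq - (F * g * X / 4 : ℚ) * hZq + (F * S / 4 : ℚ) * hq +
        (S / 2 : ℚ) * hFq

theorem free_iff : Module.Free (nonclassicalOrder σ τ) (𝓞 L) ↔
    ∃ F X Y : ℤ, (F = 1 ∨ F = -1) ∧ X ^ 2 + g * a' * Y ^ 2 = 2 * g * F := by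
  constructor
  · intro hf
    obtain ⟨E, hE, hE1⟩ := B.exists_trace
    obtain ⟨θ, hθ⟩ := exists_generator_of_free hf E hE hE1
    exact B.solvable_of_generator hθ
  · rintro ⟨F, X, Y, hF, h⟩
    have hg : Squarefree g := (squarefree_mul_iff.1 B.squarefree_a).2.1
    -- The equation gives `g ∣ X²`, and `g` is squarefree.
    obtain ⟨X, rfl⟩ : g ∣ X := by
      rw [← hg.dvd_pow_iff_dvd two_ne_zero]
      exact ⟨2 * F - a' * Y ^ 2, by linear_combination h⟩
    have h' : g * (g * X ^ 2 + a' * Y ^ 2) = g * (2 * F) := by linear_combination h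
    exact B.free_of_norm_form hF (mul_left_cancel₀ B.g_pos.ne' h')

end Biquadratic
end Order

/-! ### Excluding one sign mod 8 -/

theorem residues_eight : ∀ a g : ZMod 8, (a = 1 ∧ (g = 1 ∨ g = 5) ∨ a = 5 ∧ (g = 3 ∨ g = 7)) →
    ∀ x y : ZMod 8, x ^ 2 + a * y ^ 2 ≠ -2 * g := by
  decide

theorem residues_eight' : ∀ a g : ZMod 8, (a = 1 ∧ (g = 3 ∨ g = 7) ∨ a = 5 ∧ (g = 1 ∨ g = 5)) →
    ∀ x y : ZMod 8, x ^ 2 + a * y ^ 2 ≠ 2 * g := by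
  decide

theorem natCast_eight_of_modEq {g r : ℕ} (h : g ≡ r [MOD 4]) :
    (g : ZMod 8) = r ∨ (g : ZMod 8) = r + 4 := by
  have : g ≡ r [MOD 8] ∨ g ≡ r + 4 [MOD 8] := by
    simp only [Nat.ModEq] at *
    omega
  simpa [← ZMod.natCast_eq_natCast_iff] using this

end HopfGalois

theorem mainTheorem9 {L : Type*} [Field L] [NumberField L] (a b : ℤ)
    (ha : Squarefree a) (hb : Squarefree b) (ha4 : a ≡ 1 [ZMOD 4])
    (α β : L) (hα : α ^ 2 = (a : L)) (hβ : β ^ 2 = (b : L))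
    (hgen : IntermediateField.adjoin ℚ {α, β} = ⊤) (hdeg : Module.finrank ℚ L = 4)
    (σ τ : Gal(L/ℚ)) (hτ : τ ≠ 1) (hτα : τ α = α) (hσα : σ α ≠ α) :
    ((a ≡ 1 [ZMOD 8] ∧ Int.gcd a b ≡ 1 [MOD 4] ∨ a ≡ 5 [ZMOD 8] ∧ Int.gcd a b ≡ 3 [MOD 4]) →
      (¬ ∃ x y : ZMod 8, x ^ 2 + (a : ZMod 8) * y ^ 2 = -2 * (Int.gcd a b : ZMod 8)) ∧
      (¬ ∃ x y : ℤ, x ^ 2 + a * y ^ 2 = -2 * (Int.gcd a b : ℤ)) ∧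
      (Module.Free (HopfGalois.nonclassicalOrder σ τ) (NumberField.RingOfIntegers L) ↔
        ∃ x y : ℤ, x ^ 2 + a * y ^ 2 = 2 * (Int.gcd a b : ℤ))) ∧
    ((a ≡ 1 [ZMOD 8] ∧ Int.gcd a b ≡ 3 [MOD 4] ∨ a ≡ 5 [ZMOD 8] ∧ Int.gcd a b ≡ 1 [MOD 4]) →
      (¬ ∃ x y : ZMod 8, x ^ 2 + (a : ZMod 8) * y ^ 2 = 2 * (Int.gcd a b : ZMod 8)) ∧
      (¬ ∃ x y : ℤ, x ^ 2 + a * y ^ 2 = 2 * (Int.gcd a b : ℤ)) ∧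
      (Module.Free (HopfGalois.nonclassicalOrder σ τ) (NumberField.RingOfIntegers L) ↔
        ∃ x y : ℤ, x ^ 2 + a * y ^ 2 = -2 * (Int.gcd a b : ℤ))) := by
  obtain ⟨a', b', e, δ, ha', B⟩ := HopfGalois.Biquadratic.of_adjoin_eq_top a b ha hb ha4 α β hα hβ
    hgen hdeg σ τ hτ hτα hσα
  have hcast : ∀ s x y : ℤ, x ^ 2 + a * y ^ 2 = s * (Int.gcd a b : ℤ) →
      (x : ZMod 8) ^ 2 + (a : ZMod 8) * (y : ZMod 8) ^ 2 = s * (Int.gcd a b : ZMod 8) := by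
    intro s x y h
    have := congrArg (Int.cast : ℤ → ZMod 8) h
    push_cast at this
    exact this
  have ha8 : ∀ r : ℤ, a ≡ r [ZMOD 8] → (a : ZMod 8) = r := fun r h =>
    (ZMod.intCast_eq_intCast_iff _ _ 8).2 h
  rw [B.free_iff, ← ha']
  constructor
  · intro h
    have h8 : ¬ ∃ x y : ZMod 8, x ^ 2 + (a : ZMod 8) * y ^ 2 = -2 * (Int.gcd a b : ZMod 8) := by
      rintro ⟨x, y, hxy⟩
      refine HopfGalois.residues_eight _ _ ?_ x y hxy
      rcases h with ⟨h1, h2⟩ | ⟨h1, h2⟩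
      · exact Or.inl ⟨by simpa using ha8 _ h1, HopfGalois.natCast_eight_of_modEq h2⟩
      · exact Or.inr ⟨by simpa using ha8 _ h1, HopfGalois.natCast_eight_of_modEq h2⟩
    have hZ : ¬ ∃ x y : ℤ, x ^ 2 + a * y ^ 2 = -2 * (Int.gcd a b : ℤ) := by
      rintro ⟨x, y, hxy⟩
      exact h8 ⟨x, y, by simpa using hcast _ x y hxy⟩
    refine ⟨h8, hZ, ?_, ?_⟩
    -- Of the two signs allowed by `free_iff`, the negative one was excluded mod 8.
    · rintro ⟨F, X, Y, rfl | rfl, hXY⟩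
      · exact ⟨X, Y, by linear_combination hXY⟩
      · exact absurd ⟨X, Y, by linear_combination hXY⟩ hZ
    · rintro ⟨X, Y, hXY⟩
      exact ⟨1, X, Y, Or.inl rfl, by linear_combination hXY⟩
  · intro h
    have h8 : ¬ ∃ x y : ZMod 8, x ^ 2 + (a : ZMod 8) * y ^ 2 = 2 * (Int.gcd a b : ZMod 8) := by
      rintro ⟨x, y, hxy⟩
      refine HopfGalois.residues_eight' _ _ ?_ x y hxy
      rcases h with ⟨h1, h2⟩ | ⟨h1, h2⟩
      · exact Or.inl ⟨by simpa using ha8 _ h1, HopfGalois.natCast_eight_of_modEq h2⟩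
      · exact Or.inr ⟨by simpa using ha8 _ h1, HopfGalois.natCast_eight_of_modEq h2⟩
    have hZ : ¬ ∃ x y : ℤ, x ^ 2 + a * y ^ 2 = 2 * (Int.gcd a b : ℤ) := by
      rintro ⟨x, y, hxy⟩
      exact h8 ⟨x, y, by simpa using hcast _ x y hxy⟩
    refine ⟨h8, hZ, ?_, ?_⟩
    · rintro ⟨F, X, Y, rfl | rfl, hXY⟩
      · exact absurd ⟨X, Y, by linear_combination hXY⟩ hZ
      · exact ⟨X, Y, by linear_combination hXY⟩
    · rintro ⟨X, Y, hXY⟩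
      exact ⟨-1, X, Y, Or.inr rfl, by linear_combination hXY⟩
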